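/- Let $\mathbb T$ be the unit circle and let $\mathcal W_S$ be the set of functions $a:\mathbb T\to\mathbb C$, $a(z)=a_0+\sum_{i\ge1}a_i(z^i+z^{-i})$ with $\sum_i|a_i|<\infty$. For $\alpha\in\mathbb C$ put $\theta=\alpha^2-1$, $h_n(z)=\theta\sum_{i=1}^{n-1}\alpha^{n-i-1}z^i+\alpha z^n$ ($n\ge1$), and define semi-infinite matrices $P_{0,\alpha}=I$ and $P_{n,\alpha}=T(z^n+z^{-n})+H(h_n)$ for $n\ge 1$, where $T(c)=(c_{j-i})_{i,j\ge1}$ and $H(v)=(v_{i+j-1})_{i,j\ge1}$. Let $P_\alpha(a)=\sum_{n\ge0}a_nP_{n,\alpha}$ (entrywise). Call $a\in\mathcal W_S$ $\alpha$-admissible if $|\alpha|\le1$, or if $|\alpha|>1$ and $a$ extends analytically to an annulus $\mathcal A(r)=\{1/r<|z|<r\}$ for some $r>|\alpha|$. Let $\mathcal P_\alpha$ be the set of the matrices $P_\alpha(b)$ with $b\in\mathcal W_S$ $\alpha$-admissible. The product of semi-infinite matrices is $(AB)_{ij}=\lim_{N\to\infty}\sum_{k\le N}A_{ik}B_{kj}$;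 an equation between products includes the existence of these limits. Let $\alpha\in\mathbb C$ and $a\in\mathcal W_S$. 1. If $a(z)\ne0$ for all $z\in\mathbb T$, then $1/a\in\mathcal W_S$. If moreover $a$ and $1/a$ are $\alpha$-admissible (which is automatic for $|\alpha|\le1$), then the series defining $P_\alpha(a)$ and $P_\alpha(1/a)$ converge absolutely entrywise and $P_\alpha(1/a)P_\alpha(a)=I$. 2. Let $f=p/q$ be a rational function in lowest terms that is defined on $a(\mathbb T)$, i.e. $q(a(z))\ne0$ for all $z\in\mathbb T$. Then $f\circ a\in\mathcal W_S$. If moreover $a$ and $f\circ a$ are $\alpha$-admissible (automatic for $|\alpha|\le1$; for $|\alpha|>1$ it says that $a$ and $f\circ a$ are analytic in $\mathcal A(r)$ for some $r>|\alpha|$), then the series defining $P_\alpha(a)$ and $P_\alpha(f\circ a)$ converge absolutely entrywise, and $$f(P_\alpha(a))=P_\alpha(f\circ a)$$ in the following two senses. (a) As semi-infinite matrices: with powers of $P_\alpha(a)$ formed by the product above, $q(P_\alpha(a))$ has a two-sided inverse in $\mathcal P_\alpha$, and $f(P_\alpha(a)):=p(P_\alpha(a))\,q(P_\alpha(a))^{-1}$,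 with the inverse taken in $\mathcal P_\alpha$, exists, is uniquely determined and equals $P_\alpha(f\circ a)$. (b) As bounded operators on $\ell^s$, for $s=2$ and for $s=\infty$: if $P_\alpha(a)$ and $P_\alpha(f\circ a)$ are the matrices of bounded operators $A$ and $B$ on $\ell^s$, then $q(A)$ is invertible and $f(A)=p(A)q(A)^{-1}=B$. Such bounded operators $A$ and $B$ exist unless $|\alpha|=1$ and $\alpha\ne\pm1$. -/

import Mathlib

open Filter Topology
open scoped ENNReal

noncomputable section

namespace QTAlgebra

/-! ### Symbols on the unit circle -/

/-- `a(z) = ∑ cᵢ zⁱ` on the unit circle with `∑ |cᵢ| < ∞` and `c₋ᵢ = cᵢ`: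
membership in the class `𝒲_S` of symmetric elements of the Wiener algebra. -/
def MemWS (a : Circle → ℂ) : Prop :=
  ∃ c : ℤ → ℂ, Summable (fun i => ‖c i‖) ∧ (∀ i, c (-i) = c i) ∧
    ∀ z : Circle, HasSum (fun i : ℤ => c i * (z : ℂ) ^ i) (a z)

/-- The `n`-th Laurent coefficient `∫_{0}^{1} a(e^{2πit}) e^{-2πint} dt` of a function on the
unit circle. -/
def laurentCoeff (a : Circle → ℂ) (n : ℤ) : ℂ :=
  fourierCoeff (T := (1 : ℝ)) (fun t => a (AddCircle.toCircle t)) n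

/-- The open annulus `𝒜(r) = {z : 1/r < |z| < r}`. -/
def annulus (r : ℝ) : Set ℂ := {z | r⁻¹ < ‖z‖ ∧ ‖z‖ < r}

/-- `a` is (the restriction to the unit circle of) an analytic function on `𝒜(r)`. -/
def AnalyticInAnnulus (r : ℝ) (a : Circle → ℂ) : Prop :=
  ∃ F : ℂ → ℂ, AnalyticOnNhd ℂ F (annulus r) ∧ ∀ z : Circle, F (z : ℂ) = a z

/-- The condition on the symbol: nothing if `|α| ≤ 1`; if `|α| > 1`, analyticity in `𝒜(r)` for
some `r > |α|`. -/
def SymbolCond (α : ℂ) (a : Circle → ℂ) : Prop :=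
  ‖α‖ ≤ 1 ∨ (1 < ‖α‖ ∧ ∃ r : ℝ, ‖α‖ < r ∧ AnalyticInAnnulus r a)

/-! ### The matrices `P_α(a)`

Semi-infinite matrices are indexed by `ℕ`, so index `i` here is the row or column `i + 1`. -/

/-- The Toeplitz matrix with entries `c_{j-i}`. -/
def toeplitz (c : ℤ → ℂ) : Matrix ℕ ℕ ℂ := fun i j => c ((j : ℤ) - (i : ℤ))

/-- The Hankel matrix of `v = (v₁, v₂, …)`: with indices from `1` its entries are `v_{i+j-1}`. -/
def hankel (v : ℕ → ℂ) : Matrix ℕ ℕ ℂ := fun i j => v (i + j + 1)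

/-- The coefficient of `z ^ k` in
`h_n(z) = (α² - 1) ∑_{i=1}^{n-1} α^{n-i-1} zⁱ + α zⁿ`, `n ≥ 1`. -/
def hCoeff (α : ℂ) (n k : ℕ) : ℂ :=
  if k = 0 ∨ n < k then 0 else if k = n then α else (α ^ 2 - 1) * α ^ (n - k - 1)

/-- `P_{0,α} = I` and `P_{n,α} = T(zⁿ + z⁻ⁿ) + H(h_n)` for `n ≥ 1`. -/
def PBasis (α : ℂ) (n : ℕ) : Matrix ℕ ℕ ℂ :=
  if n = 0 then 1
  else toeplitz (fun k => if k = (n : ℤ) ∨ k = -(n : ℤ) then 1 else 0) + hankel (hCoeff α n)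

/-- The series `∑_{n ≥ 0} a_n P_{n,α}` converges (entrywise, absolutely). -/
def PAlphaConverges (α : ℂ) (a : Circle → ℂ) : Prop :=
  ∀ i j, Summable fun n : ℕ => laurentCoeff a n * PBasis α n i j

/-- `P_α(a) = ∑_{n ≥ 0} a_n P_{n,α}`. -/
def PAlpha (α : ℂ) (a : Circle → ℂ) : Matrix ℕ ℕ ℂ :=
  fun i j => ∑' n : ℕ, laurentCoeff a n * PBasis α n i j

/-- The algebra `𝒫_α` of the matrices `P_α(b)`, where `b ∈ 𝒲_S` is analytic in some `𝒜(r)`,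
`r > |α|`, if `|α| > 1`. -/
def PSet (α : ℂ) : Set (Matrix ℕ ℕ ℂ) :=
  {M | ∃ b : Circle → ℂ, MemWS b ∧ SymbolCond α b ∧ M = PAlpha α b}

/-! ### Arithmetic and rational functions of semi-infinite matrices -/

/-- `A B = C` for semi-infinite matrices: every series `∑_k A_{ik} B_{kj}` converges,
with sum `C_{ij}`. -/
def IsProd (A B C : Matrix ℕ ℕ ℂ) : Prop :=
  ∀ i j, Tendsto (fun N : ℕ => ∑ k ∈ Finset.range N, A i k * B k j) atTop (𝓝 (C i j))

/-- `p(A) = C` for a polynomial `p`; `W n` is the power `Aⁿ`. -/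
def IsPolyValue (p : Polynomial ℂ) (A C : Matrix ℕ ℕ ℂ) : Prop :=
  ∃ W : ℕ → Matrix ℕ ℕ ℂ, W 0 = 1 ∧ (∀ n, IsProd (W n) A (W (n + 1))) ∧
    C = ∑ n ∈ p.support, p.coeff n • W n

/-- `f(A) = C` for a rational function `f = p / q` in lowest terms: `C = p(A) q(A)⁻¹`, where the
inverse `E` of `q(A)` is taken in the algebra `𝒫_α`. -/
def IsRatValue (α : ℂ) (f : RatFunc ℂ) (A C : Matrix ℕ ℕ ℂ) : Prop :=
  ∃ N D E : Matrix ℕ ℕ ℂ, IsPolyValue f.num A N ∧ IsPolyValue f.denom A D ∧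
    E ∈ PSet α ∧ IsProd D E 1 ∧ IsProd E D 1 ∧ IsProd N E C

/-! ### Bounded operators on `ℓ^p` -/

/-- The sequence space `ℓ^p` over `ℂ`. -/
abbrev Ell (p : ℝ≥0∞) := lp (fun _ : ℕ => ℂ) p

/-- The bounded operator `A` on `ℓ^p` is given by the semi-infinite matrix `M`. -/
def IsMatrixOf {p : ℝ≥0∞} [Fact (1 ≤ p)] (M : Matrix ℕ ℕ ℂ) (A : Ell p →L[ℂ] Ell p) : Prop :=
  ∀ (x : Ell p) (i : ℕ), HasSum (fun j => M i j * x j) (A x i)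

/-- `f(A) = p(A) q(A)⁻¹` for a rational function `f = p / q` in lowest terms and a bounded
operator `A` (meaningful if `q(A)` is invertible). -/
def ratOp {p : ℝ≥0∞} [Fact (1 ≤ p)] (f : RatFunc ℂ) (A : Ell p →L[ℂ] Ell p) :
    Ell p →L[ℂ] Ell p :=
  Polynomial.aeval A f.num * Ring.inverse (Polynomial.aeval A f.denom)

/-- The value `f(w)` of a rational function; meaningful if `w` is not a pole. -/
def ratEval (f : RatFunc ℂ) (w : ℂ) : ℂ := f.eval (RingHom.id ℂ) w

end QTAlgebra

end

noncomputable section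

namespace QTAlgebra

/-! ### Coefficient sequences -/

/-! The map `a ↦ P_α(a)` is an algebra homomorphism on admissible symbols, and everything else is
formal. Write `P̃_n` for `T(zⁿ + z⁻ⁿ) + H(h_n)`, with `P̃_0 = 2I`. These matrices satisfy the
three-term recurrence of the Chebyshev polynomials `C_n` (normalized by `C_n(x + 1/x) = xⁿ + x⁻ⁿ`),
so `P̃_n = C_n(P_{1,α})` (`aeval_tridiag_C`). Hence `C_m C_n = C_{m+n} + C_{m-n}` gives `P̃_m P̃_n =
P̃_{m+n} + P̃_{|m-n|}`, which is the multiplication rule of the symbols `zⁿ + z⁻ⁿ`.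

Passing to infinite series is the analytic point. Entries of `P̃_n` are `O(max(1,|α|)ⁿ)`, and
admissibility makes the Laurent coefficients summable against this weight: for `|α| > 1` this is
Cauchy's estimate (`Admissible.exists_isCoeffs`). The truncated products `∑_{k<K}` of `P̃_m` and
`P̃_n` are bounded by `C max(1,|α|)^(m+n)` uniformly in `K` (`exists_norm_sum_PTilde_le`), so
dominated convergence yields `P_α(a) P_α(b) = P_α(ab)` (`IsCoeffs.isProd_PAlpha`).

That `1/a` stays in the Wiener class is Wiener's lemma, proved with characters of the closed algebra
generated by translations of `ℓ¹(ℤ)`. For `f = p/q`, a Bézout relation `u p + v q = 1` gives `1/q(a)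
= u(a) f(a) + v(a)`, so `1/q(a)` is admissible as soon as `a` and `f ∘ a` are. The same formula,
with operators in place of symbols, inverts `q(A)`. Existence of the operators follows from uniform
bounds on row sums and, on `ℓ²`, Schur's test. -/

/-- `c` is a symmetric sequence of Laurent coefficients of `a` on the unit circle, with
`∑ |cᵢ| ρ^|i| < ∞`. -/
structure IsCoeffs (ρ : ℝ) (a : Circle → ℂ) (c : ℤ → ℂ) : Prop where
  summable : Summable fun i : ℤ => ‖c i‖ * ρ ^ i.natAbs
  symm : ∀ i, c (-i) = c i
  hasSum : ∀ z : Circle, HasSum (fun i : ℤ => c i * (z : ℂ) ^ i) (a z)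

/-- The convolution of two sequences on `ℤ`. -/
def conv (c d : ℤ → ℂ) (l : ℤ) : ℂ := ∑' k, c k * d (l - k)

lemma pow_natAbs_add_le {ρ : ℝ} (hρ : 1 ≤ ρ) (m n : ℤ) :
    ρ ^ (m + n).natAbs ≤ ρ ^ m.natAbs * ρ ^ n.natAbs := by
  rw [← pow_add]
  exact pow_le_pow_right₀ hρ (Int.natAbs_add_le m n)

/-- The shear `(k, l) ↦ (k, l - k)` of `ℤ × ℤ`. -/
def shear : ℤ × ℤ ≃ ℤ × ℤ where
  toFun p := (p.1, p.2 - p.1)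
  invFun p := (p.1, p.1 + p.2)
  left_inv p := by simp
  right_inv p := by simp

section Conv

variable {ρ : ℝ} {c d : ℤ → ℂ}

lemma summable_weight_mul (hρ : 1 ≤ ρ) (hc : Summable fun i : ℤ => ‖c i‖ * ρ ^ i.natAbs)
    (hd : Summable fun i : ℤ => ‖d i‖ * ρ ^ i.natAbs) :
    Summable fun p : ℤ × ℤ => ‖c p.1‖ * ‖d p.2‖ * (ρ ^ p.1.natAbs * ρ ^ p.2.natAbs) := by
  have h0 : 0 ≤ ρ := by linarith
  refine (hc.mul_of_nonneg hd (fun i => by positivity) fun i => by positivity).congr fun p => ?_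
  ring

lemma summable_conv_kernel (hρ : 1 ≤ ρ) (hc : Summable fun i : ℤ => ‖c i‖ * ρ ^ i.natAbs)
    (hd : Summable fun i : ℤ => ‖d i‖ * ρ ^ i.natAbs) :
    Summable fun p : ℤ × ℤ => ‖c p.1‖ * ‖d (p.2 - p.1)‖ * ρ ^ p.2.natAbs := by
  have h0 : 0 ≤ ρ := by linarith
  have h1 : Summable fun p : ℤ × ℤ => ‖c p.1‖ * ‖d p.2‖ * ρ ^ (p.1 + p.2).natAbs := by
    refine Summable.of_nonneg_of_le (fun p => by positivity) (fun p => ?_)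
      (summable_weight_mul hρ hc hd)
    gcongr
    exact pow_natAbs_add_le hρ _ _
  have := (shear.summable_iff).2 h1
  simpa [Function.comp_def, shear] using this

lemma summable_conv (hρ : 1 ≤ ρ) (hc : Summable fun i : ℤ => ‖c i‖ * ρ ^ i.natAbs)
    (hd : Summable fun i : ℤ => ‖d i‖ * ρ ^ i.natAbs) :
    Summable fun i : ℤ => ‖conv c d i‖ * ρ ^ i.natAbs := by
  have h0 : 0 < ρ := by linarith
  have h := (Equiv.prodComm ℤ ℤ).summable_iff.2 (summable_conv_kernel hρ hc hd)
  refine Summable.of_nonneg_of_le (fun p => by positivity) (fun l => ?_) h.prod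
  have hl : Summable fun k => ‖c k‖ * ‖d (l - k)‖ := by
    refine (summable_mul_right_iff (pow_pos h0 l.natAbs).ne').1 ((h.prod_factor l).congr fun k => ?_)
    simp
  simp only [Function.comp_def, Equiv.prodComm_apply, Prod.swap_prod_mk, tsum_mul_right]
  gcongr
  simp only [← norm_mul] at hl ⊢
  exact norm_tsum_le_tsum_norm hl

/-- Summation of a double series against a function of `m + n`, through the convolution. -/
lemma hasSum_conv (hρ : 1 ≤ ρ) (hc : Summable fun i : ℤ => ‖c i‖ * ρ ^ i.natAbs)
    (hd : Summable fun i : ℤ => ‖d i‖ * ρ ^ i.natAbs) {φ : ℤ → ℂ} {s : ℂ}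
    (hs : HasSum (fun p : ℤ × ℤ => c p.1 * d p.2 * φ (p.1 + p.2)) s) :
    HasSum (fun l => conv c d l * φ l) s := by
  have h0 : 0 < ρ := by linarith
  have h1 : HasSum (fun p : ℤ × ℤ => c p.2 * d (p.1 - p.2) * φ p.1) s := by
    have := (shear.hasSum_iff).2 hs
    have := (Equiv.prodComm ℤ ℤ).hasSum_iff.2 this
    simpa [Function.comp_def, shear] using this
  refine h1.prod_fiberwise fun l => ?_
  have h := (Equiv.prodComm ℤ ℤ).summable_iff.2 (summable_conv_kernel hρ hc hd)
  have hl : Summable fun k => ‖c k‖ * ‖d (l - k)‖ := by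
    refine (summable_mul_right_iff (pow_pos h0 l.natAbs).ne').1 ((h.prod_factor l).congr fun k => ?_)
    simp
  simp only [← norm_mul] at hl
  exact hl.of_norm.hasSum.mul_right _

end Conv

lemma hasSum_mul_of_summable_norm {f g : ℤ → ℂ} {s t : ℂ} (hf : HasSum f s) (hg : HasSum g t)
    (hf' : Summable fun i => ‖f i‖) (hg' : Summable fun i => ‖g i‖) :
    HasSum (fun p : ℤ × ℤ => f p.1 * g p.2) (s * t) :=
  hf.mul hg (summable_mul_of_summable_norm hf' hg')

/-- The Laurent series of a convolution is the product of the Laurent series. -/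
lemma hasSum_conv_zpow {c d : ℤ → ℂ} (hc : Summable fun i => ‖c i‖) (hd : Summable fun i => ‖d i‖)
    {z : Circle} {s t : ℂ} (hs : HasSum (fun i : ℤ => c i * (z : ℂ) ^ i) s)
    (ht : HasSum (fun i : ℤ => d i * (z : ℂ) ^ i) t) :
    HasSum (fun l : ℤ => conv c d l * (z : ℂ) ^ l) (s * t) := by
  have h := hasSum_mul_of_summable_norm hs ht (by simpa [Circle.norm_coe] using hc)
    (by simpa [Circle.norm_coe] using hd)
  refine hasSum_conv (ρ := 1) le_rfl (by simpa using hc) (by simpa using hd)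
    (φ := fun l => (z : ℂ) ^ l) ?_
  convert h using 2 with p
  simp only [zpow_add₀ z.coe_ne_zero]
  ring

namespace IsCoeffs

variable {ρ : ℝ} {a b : Circle → ℂ} {c d : ℤ → ℂ}

lemma mono {σ : ℝ} (hσ : 0 ≤ σ) (h : σ ≤ ρ) (ha : IsCoeffs ρ a c) : IsCoeffs σ a c where
  summable := Summable.of_nonneg_of_le (fun i => by positivity)
    (fun i => by gcongr) ha.summable
  symm := ha.symm
  hasSum := ha.hasSum

lemma summable_norm (hρ : 1 ≤ ρ) (ha : IsCoeffs ρ a c) : Summable fun i => ‖c i‖ := by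
  simpa using (ha.mono zero_le_one hρ).summable

lemma add (ha : IsCoeffs ρ a c) (hb : IsCoeffs ρ b d) (hρ : 0 ≤ ρ) :
    IsCoeffs ρ (a + b) (c + d) where
  summable := by
    refine Summable.of_nonneg_of_le (fun i => by positivity) (fun i => ?_)
      (ha.summable.add hb.summable)
    rw [← add_mul]
    gcongr
    exact norm_add_le _ _
  symm i := by simp [ha.symm, hb.symm]
  hasSum z := by simpa [add_mul] using (ha.hasSum z).add (hb.hasSum z)

lemma smul (ha : IsCoeffs ρ a c) (k : ℂ) : IsCoeffs ρ (k • a) (k • c) where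
  summable := by simpa [mul_assoc] using ha.summable.mul_left ‖k‖
  symm i := by simp [ha.symm]
  hasSum z := by simpa [mul_assoc] using (ha.hasSum z).mul_left k

lemma const (ρ : ℝ) (k : ℂ) : IsCoeffs ρ (fun _ => k) (fun i => if i = 0 then k else 0) where
  summable := summable_of_ne_finset_zero (s := {0}) (by simp +contextual)
  symm i := by simp
  hasSum z := by
    convert hasSum_ite_eq (0 : ℤ) k using 2 with i
    split_ifs with h <;> simp [h]

lemma conv_symm (hc : ∀ i, c (-i) = c i) (hd : ∀ i, d (-i) = d i) (i : ℤ) :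
    conv c d (-i) = conv c d i := by
  unfold conv
  rw [← (Equiv.neg ℤ).tsum_eq]
  refine tsum_congr fun k => ?_
  rw [Equiv.neg_apply, hc, ← hd (i - k)]
  congr 2
  ring

lemma mul (hρ : 1 ≤ ρ) (ha : IsCoeffs ρ a c) (hb : IsCoeffs ρ b d) :
    IsCoeffs ρ (a * b) (conv c d) :=
  ⟨summable_conv hρ ha.summable hb.summable, conv_symm ha.symm hb.symm, fun z =>
    hasSum_conv_zpow (ha.summable_norm hρ) (hb.summable_norm hρ) (ha.hasSum z) (hb.hasSum z)⟩

/-- The coefficients of an absolutely convergent Laurent series are its Fourier coefficients. -/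
lemma laurentCoeff_eq (hρ : 1 ≤ ρ) (ha : IsCoeffs ρ a c) (n : ℤ) : laurentCoeff a n = c n := by
  have hF : ∀ i : ℤ, MeasureTheory.Integrable
      (fun t : AddCircle (1 : ℝ) => fourier (-n) t * (c i * fourier i t))
      AddCircle.haarAddCircle := fun i =>
    (by fun_prop : Continuous fun t : AddCircle (1 : ℝ) =>
      fourier (-n) t * (c i * fourier i t)).integrable_of_hasCompactSupport
      (HasCompactSupport.of_compactSpace _)
  have h := MeasureTheory.hasSum_integral_of_summable_integral_norm hF (by
    simpa [fourier_apply, Circle.norm_coe] using ha.summable_norm hρ)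
  have h1 : ∀ i : ℤ, ∫ t : AddCircle (1 : ℝ), fourier (-n) t * (c i * fourier i t)
      ∂AddCircle.haarAddCircle = if i = n then c n else 0 := by
    intro i
    have h2 := congrFun (fourierCoeff_fourier (T := 1) i) n
    unfold fourierCoeff at h2
    simp only [smul_eq_mul] at h2
    simp_rw [mul_left_comm _ (c i)]
    rw [MeasureTheory.integral_const_mul, h2]
    by_cases hin : i = n
    · simp [hin]
    · simp [hin, Ne.symm hin]
  simp_rw [h1] at h
  rw [← (hasSum_ite_eq n (c n)).unique h |>.symm]
  unfold laurentCoeff fourierCoeff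
  refine MeasureTheory.integral_congr_ae (.of_forall fun t => ?_)
  have h3 := ((ha.hasSum (AddCircle.toCircle t)).mul_left (fourier (-n) t)).tsum_eq
  simp only [smul_eq_mul]
  rw [← h3]
  refine tsum_congr fun i => ?_
  rw [fourier_apply (n := i), AddCircle.toCircle_zsmul, Circle.coe_zpow]

end IsCoeffs

/-! ### Admissible symbols -/

lemma memWS_iff {a : Circle → ℂ} : MemWS a ↔ ∃ c, IsCoeffs 1 a c := by
  constructor
  · rintro ⟨c, h1, h2, h3⟩
    exact ⟨c, by simpa using h1, h2, h3⟩
  · rintro ⟨c, h1, h2, h3⟩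
    exact ⟨c, by simpa using h1, h2, h3⟩

-- Parametrizing by `z = e^{2πit}` turns `dz/z` into `2πi dt`. The contour form is what allows the
-- radius to be changed in Cauchy's estimate.
open Real in
lemma circleIntegral_eq_laurentCoeff {F : ℂ → ℂ} {a : Circle → ℂ} (hF : ∀ z : Circle, F z = a z)
    (n : ℤ) : (∮ z in C(0, 1), F z * z ^ (-n - 1)) = 2 * π * Complex.I * laurentCoeff a n := by
  unfold laurentCoeff
  rw [fourierCoeff_eq_intervalIntegral _ _ 0, circleIntegral]
  have h : ∀ x : ℝ, fourier (T := 1) (-n) (x : AddCircle (1 : ℝ)) •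
      a (AddCircle.toCircle (x : AddCircle (1 : ℝ))) =
      (fun θ : ℝ => circleMap 0 1 θ ^ (-n) * F (circleMap 0 1 θ)) (2 * π * x) := by
    intro x
    have h1 : ((AddCircle.toCircle (x : AddCircle (1 : ℝ)) : Circle) : ℂ) =
        circleMap 0 1 (2 * π * x) := by
      rw [AddCircle.toCircle_apply_mk, Circle.coe_exp, circleMap_zero]
      simp
    rw [fourier_apply, AddCircle.toCircle_zsmul, Circle.coe_zpow, ← hF, h1, smul_eq_mul]
  simp_rw [h]
  rw [intervalIntegral.integral_comp_mul_left (fun θ : ℝ => circleMap 0 1 θ ^ (-n) *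
    F (circleMap 0 1 θ)) (by positivity)]
  simp only [zero_add, mul_zero, mul_one, div_one, one_smul]
  have h2 : ∀ θ : ℝ, deriv (circleMap 0 1) θ • (F (circleMap 0 1 θ) * circleMap 0 1 θ ^ (-n - 1)) =
      Complex.I * (circleMap 0 1 θ ^ (-n) * F (circleMap 0 1 θ)) := by
    intro θ
    have h0 : circleMap 0 1 θ ≠ 0 := circleMap_ne_center one_ne_zero
    rw [deriv_circleMap, smul_eq_mul, zpow_sub_one₀ h0]
    field_simp
  simp_rw [h2]
  rw [intervalIntegral.integral_const_mul, Complex.real_smul]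
  have : (π : ℂ) ≠ 0 := by exact_mod_cast pi_ne_zero
  push_cast
  field_simp

/-- Cauchy's estimate: the Laurent coefficients of a function analytic in an annulus decay
geometrically. -/
lemma exists_norm_laurentCoeff_le {a : Circle → ℂ} {r s : ℝ} (hs : 1 ≤ s) (hsr : s < r)
    (ha : AnalyticInAnnulus r a) : ∃ M, ∀ n : ℕ, ‖laurentCoeff a n‖ ≤ M * (s ^ n)⁻¹ := by
  obtain ⟨F, hF, hFa⟩ := ha
  have hs0 : 0 < s := by linarith
  have hr1 : r⁻¹ < 1 := inv_lt_one_of_one_lt₀ (by linarith)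
  have hsub : Metric.closedBall (0 : ℂ) s \ Metric.ball 0 1 ⊆ annulus r := by
    rintro z ⟨h1, h2⟩
    simp only [Metric.mem_closedBall, Metric.mem_ball, dist_zero_right, not_lt] at h1 h2
    exact ⟨by linarith, by linarith⟩
  obtain ⟨M, hM⟩ := (isCompact_sphere (0 : ℂ) s).exists_bound_of_continuousOn
    (f := F) (hF.continuousOn.mono fun z hz => hsub (by
      simp only [mem_sphere_iff_norm, sub_zero] at hz
      simp [hz, hs]))
  refine ⟨M, fun n => ?_⟩
  have hz0 : ∀ z ∈ Metric.closedBall (0 : ℂ) s \ Metric.ball 0 1, z ≠ 0 := by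
    rintro z ⟨h1, h2⟩ rfl
    simp at h2
  have hA : ∀ z ∈ Metric.closedBall (0 : ℂ) s \ Metric.ball 0 1,
      DifferentiableAt ℂ (fun z => F z * z ^ (-(n : ℤ) - 1)) z := fun z hz =>
    (hF z (hsub hz)).differentiableAt.mul (differentiableAt_zpow.2 (Or.inl (hz0 z hz)))
  -- The contour moves from `|z| = 1` to `|z| = s`, where `|z^(-n-1)| = s^(-n-1)` supplies the
  -- decay.
  have h1 := Complex.circleIntegral_eq_of_differentiable_on_annulus_off_countable (c := 0)
    one_pos hs Set.countable_empty (fun z hz => (hA z hz).continuousAt.continuousWithinAt)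
    (fun z hz => hA z ⟨Metric.ball_subset_closedBall hz.1.1,
      fun h => hz.1.2 (Metric.ball_subset_closedBall h)⟩)
  rw [circleIntegral_eq_laurentCoeff hFa] at h1
  have h2 := circleIntegral.norm_integral_le_of_norm_le_const
    (f := fun z => F z * z ^ (-(n : ℤ) - 1)) (c := 0) (R := s) (C := M * s ^ (-(n : ℤ) - 1))
    hs0.le (fun z hz => by
      rw [norm_mul, norm_zpow]
      have := hM z hz
      simp only [mem_sphere_iff_norm, sub_zero] at hz
      rw [hz]
      gcongr)
  rw [h1] at h2
  have hpi := Real.pi_pos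
  simp only [norm_mul, Complex.norm_ofNat, Complex.norm_real, Complex.norm_I, mul_one,
    Real.norm_of_nonneg hpi.le] at h2
  rw [zpow_sub_one₀ hs0.ne', zpow_neg, zpow_natCast] at h2
  have h3 : 2 * Real.pi * s * (M * ((s ^ n)⁻¹ * s⁻¹)) = 2 * Real.pi * (M * (s ^ n)⁻¹) := by
    field_simp
  rw [h3] at h2
  exact le_of_mul_le_mul_left h2 (by positivity)

/-- `a ∈ 𝒲_S` satisfies the condition on symbols. -/
structure Admissible (α : ℂ) (a : Circle → ℂ) : Prop where
  memWS : MemWS a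
  symbolCond : SymbolCond α a

/-- The weight `max 1 ‖α‖` is the growth rate of the entries of `P_{n,α}`, so this is the
summability that all later series in `P_{n,α}` rely on. -/
lemma Admissible.exists_isCoeffs {α : ℂ} {a : Circle → ℂ} (ha : Admissible α a) :
    ∃ c, IsCoeffs (max 1 ‖α‖) a c := by
  obtain ⟨c, hc⟩ := memWS_iff.1 ha.memWS
  rcases ha.symbolCond with h | ⟨h, r, hr, hra⟩
  · exact ⟨c, by rwa [max_eq_left h]⟩
  · rw [max_eq_right h.le]
    refine ⟨c, ?_, hc.symm, hc.hasSum⟩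
    -- Cauchy's estimate on a radius strictly between `|α|` and `r` leaves a geometric series of
    -- ratio `|α|/s < 1`.
    obtain ⟨s, hs1, hs2⟩ := exists_between hr
    have hs0 : 0 < s := by linarith
    obtain ⟨M, hM⟩ := exists_norm_laurentCoeff_le (by linarith) hs2 hra
    have hN : Summable fun n : ℕ => ‖c n‖ * ‖α‖ ^ n := by
      refine Summable.of_nonneg_of_le (fun n => by positivity) (fun n => ?_)
        ((summable_geometric_of_lt_one (r := ‖α‖ / s) (by positivity)
          ((div_lt_one hs0).2 hs1)).mul_left M)
      rw [← hc.laurentCoeff_eq le_rfl]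
      calc _ ≤ M * (s ^ n)⁻¹ * ‖α‖ ^ n := by gcongr; exact hM n
        _ = _ := by rw [div_pow]; ring
    refine Summable.of_nat_of_neg ?_ ?_
    · simpa using hN
    · simpa [hc.symm] using hN

lemma MemWS.const (k : ℂ) : MemWS fun _ => k := memWS_iff.2 ⟨_, IsCoeffs.const 1 k⟩

lemma MemWS.add {a b : Circle → ℂ} (ha : MemWS a) (hb : MemWS b) : MemWS (a + b) := by
  obtain ⟨c, hc⟩ := memWS_iff.1 ha
  obtain ⟨d, hd⟩ := memWS_iff.1 hb
  exact memWS_iff.2 ⟨_, hc.add hd zero_le_one⟩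

lemma MemWS.mul {a b : Circle → ℂ} (ha : MemWS a) (hb : MemWS b) : MemWS (a * b) := by
  obtain ⟨c, hc⟩ := memWS_iff.1 ha
  obtain ⟨d, hd⟩ := memWS_iff.1 hb
  exact memWS_iff.2 ⟨_, hc.mul le_rfl hd⟩

lemma annulus_subset {r s : ℝ} (hr : 0 < r) (h : r ≤ s) : annulus r ⊆ annulus s :=
  fun _ hz => ⟨(inv_anti₀ hr h).trans_lt hz.1, hz.2.trans_le h⟩

/-- A pointwise operation that preserves analyticity preserves the condition on symbols. -/
lemma SymbolCond.map₂ {α : ℂ} {a b : Circle → ℂ} (op : ℂ → ℂ → ℂ)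
    (hop : ∀ (F G : ℂ → ℂ) (U : Set ℂ), AnalyticOnNhd ℂ F U → AnalyticOnNhd ℂ G U →
      AnalyticOnNhd ℂ (fun z => op (F z) (G z)) U)
    (ha : SymbolCond α a) (hb : SymbolCond α b) : SymbolCond α fun z => op (a z) (b z) := by
  rcases ha with h | ⟨h, r, hr, F, hF, hFa⟩
  · exact Or.inl h
  rcases hb with h' | ⟨-, s, hs, G, hG, hGb⟩
  · exact Or.inl h'
  refine Or.inr ⟨h, min r s, lt_min hr hs, fun z => op (F z) (G z), hop F G _ ?_ ?_, fun z => ?_⟩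
  · exact hF.mono (annulus_subset (lt_min (by linarith) (by linarith)) (min_le_left _ _))
  · exact hG.mono (annulus_subset (lt_min (by linarith) (by linarith)) (min_le_right _ _))
  · simp [hFa, hGb]

lemma SymbolCond.const (α k : ℂ) : SymbolCond α fun _ => k := by
  rcases le_or_gt ‖α‖ 1 with h | h
  · exact Or.inl h
  · exact Or.inr ⟨h, ‖α‖ + 1, by linarith, fun _ => k, analyticOnNhd_const, fun _ => rfl⟩

/-- The algebra of admissible symbols. -/
def admissibleAlgebra (α : ℂ) : Subalgebra ℂ (Circle → ℂ) where
  carrier := {a | Admissible α a}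
  mul_mem' ha hb := ⟨ha.memWS.mul hb.memWS,
    ha.symbolCond.map₂ (· * ·) (fun _ _ _ => AnalyticOnNhd.mul) hb.symbolCond⟩
  add_mem' ha hb := ⟨ha.memWS.add hb.memWS,
    ha.symbolCond.map₂ (· + ·) (fun _ _ _ => AnalyticOnNhd.add) hb.symbolCond⟩
  algebraMap_mem' k := ⟨MemWS.const k, SymbolCond.const α k⟩

lemma Admissible.aeval {α : ℂ} {a : Circle → ℂ} (ha : Admissible α a) (p : Polynomial ℂ) :
    Admissible α (Polynomial.aeval a p) :=
  Algebra.adjoin_le (S := admissibleAlgebra α) (Set.singleton_subset_iff.2 ha)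
    (Polynomial.aeval_mem_adjoin_singleton ℂ a)

/-! ### The matrices `P̃_n = T(zⁿ + z⁻ⁿ) + H(h_n)` -/

/-- The function `g` on `ℤ` with `h_n = ∑_{k ≥ 1} g(n - k) z^k`. -/
def hankelKernel (α : ℂ) (t : ℤ) : ℂ :=
  if t < 0 then 0 else if t = 0 then α else (α ^ 2 - 1) * α ^ (t.toNat - 1)

/-- The matrices `P_{n,α}`, for all `n : ℕ` given by the same formula (so `2 I` for `n = 0`). -/
def PTilde (α : ℂ) (n : ℕ) (i j : ℕ) : ℂ :=
  (if (j : ℤ) = i + n then 1 else 0) + (if (i : ℤ) = j + n then 1 else 0) +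
    hankelKernel α (n - i - j - 1)

section Matrices

variable (α : ℂ)

lemma hankelKernel_of_neg {t : ℤ} (ht : t < 0) : hankelKernel α t = 0 := by
  simp [hankelKernel, ht]

lemma hankelKernel_zero : hankelKernel α 0 = α := by simp [hankelKernel]

lemma hankelKernel_natCast_add_one (t : ℕ) :
    hankelKernel α (t + 1) = (α ^ 2 - 1) * α ^ t := by
  have h1 : ¬ ((t : ℤ) + 1 < 0) := by omega
  have h2 : ¬ ((t : ℤ) + 1 = 0) := by omega
  simp [hankelKernel, h1, h2]

/-- The kernel is the coefficient sequence of `(α - x)/(1 - αx)`; the two correction terms are the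
coefficients of the numerator. -/
lemma hankelKernel_add_one (t : ℤ) : hankelKernel α (t + 1) =
    α * hankelKernel α t + (if t = -1 then α else 0) - (if t = 0 then 1 else 0) := by
  rcases lt_trichotomy t 0 with h | rfl | h
  · rcases eq_or_ne t (-1) with rfl | h'
    · simp [hankelKernel_zero, hankelKernel_of_neg]
    · rw [hankelKernel_of_neg α h, hankelKernel_of_neg α (by omega)]
      simp [h', h.ne]
  · have := hankelKernel_natCast_add_one α 0
    simp only [Nat.cast_zero, zero_add, pow_zero, mul_one] at this
    rw [zero_add, this, hankelKernel_zero]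
    simp
    ring
  · obtain ⟨m, rfl⟩ : ∃ m : ℕ, t = m + 1 := ⟨(t - 1).toNat, by omega⟩
    have h1 : ¬ ((m : ℤ) + 1 = -1) := by omega
    have h2 : ¬ ((m : ℤ) + 1 = 0) := by omega
    have h3 := hankelKernel_natCast_add_one α (m + 1)
    push_cast at h3
    rw [hankelKernel_natCast_add_one, h3]
    simp only [h1, h2, if_false]
    ring

lemma norm_hankelKernel_le {t : ℤ} {n : ℕ} (h : t ≤ n) :
    ‖hankelKernel α t‖ ≤ (‖α‖ + ‖α ^ 2 - 1‖) * max 1 ‖α‖ ^ n := by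
  have h1 : 1 ≤ max 1 ‖α‖ ^ n := one_le_pow₀ (le_max_left _ _)
  rcases lt_trichotomy t 0 with h' | rfl | h'
  · rw [hankelKernel_of_neg α h', norm_zero]
    positivity
  · rw [hankelKernel_zero]
    nlinarith [norm_nonneg α, norm_nonneg (α ^ 2 - 1)]
  · obtain ⟨m, rfl⟩ : ∃ m : ℕ, t = m + 1 := ⟨(t - 1).toNat, by omega⟩
    rw [hankelKernel_natCast_add_one, norm_mul, norm_pow, add_mul]
    have h2 : ‖α‖ ^ m ≤ max 1 ‖α‖ ^ n :=
      (pow_le_pow_left₀ (norm_nonneg _) (le_max_right _ _) m).trans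
        (pow_le_pow_right₀ (le_max_left _ _) (by omega))
    have : 0 ≤ ‖α‖ * max 1 ‖α‖ ^ n := by positivity
    nlinarith [mul_le_mul_of_nonneg_left h2 (norm_nonneg (α ^ 2 - 1))]

lemma PBasis_eq_PTilde {n : ℕ} (hn : n ≠ 0) : PBasis α n = PTilde α n := by
  funext i j
  simp only [PBasis, hn, if_false, PTilde, Matrix.add_apply, toeplitz, hankel]
  congr 1
  · have h1 : (j : ℤ) - i = n ↔ (j : ℤ) = i + n := by omega
    have h2 : (j : ℤ) - i = -n ↔ (i : ℤ) = j + n := by omega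
    simp only [h1, h2]
    split_ifs <;> first | omega | simp_all
  · unfold hCoeff
    by_cases h1 : n < i + j + 1
    · rw [hankelKernel_of_neg α (by omega)]
      simp [h1]
    · by_cases h2 : i + j + 1 = n
      · have : (n : ℤ) - i - j - 1 = 0 := by omega
        rw [this, hankelKernel_zero]
        simp [h2]
        omega
      · have : (n : ℤ) - i - j - 1 = ((n - (i + j + 1) - 1 : ℕ) : ℤ) + 1 := by omega
        rw [this, hankelKernel_natCast_add_one]
        simp [h1, h2]

lemma PTilde_zero (i j : ℕ) : PTilde α 0 i j = 2 * (1 : Matrix ℕ ℕ ℂ) i j := by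
  rw [PTilde, hankelKernel_of_neg α (by omega)]
  by_cases h : i = j
  · subst h
    rw [Matrix.one_apply_eq]
    simp
    norm_num
  · simp [h, Ne.symm h]

lemma PTilde_symm (n i j : ℕ) : PTilde α n i j = PTilde α n j i := by
  unfold PTilde
  rw [show (n : ℤ) - i - j - 1 = n - j - i - 1 by ring]
  ring

lemma norm_PTilde_le (n i j : ℕ) :
    ‖PTilde α n i j‖ ≤ (2 + ‖α‖ + ‖α ^ 2 - 1‖) * max 1 ‖α‖ ^ n := by
  have h1 : 1 ≤ max 1 ‖α‖ ^ n := one_le_pow₀ (le_max_left _ _)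
  have h2 := norm_hankelKernel_le α (t := n - i - j - 1) (n := n) (by omega)
  have h3 : ∀ (q : Prop) [Decidable q], ‖(if q then 1 else 0 : ℂ)‖ ≤ 1 := by
    intro q _
    split_ifs <;> simp
  calc _ ≤ 1 + 1 + _ := (norm_add_le _ _).trans
        (add_le_add ((norm_add_le _ _).trans (add_le_add (h3 _) (h3 _))) h2)
    _ ≤ _ := by nlinarith

/-! #### The recursion and the product formula -/

/-- The tridiagonal operator `P_{1,α}` on all sequences. -/
def tridiag : (ℕ → ℂ) →ₗ[ℂ] (ℕ → ℂ) where
  toFun x i := (if i = 0 then α * x 0 else x (i - 1)) + x (i + 1)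
  map_add' x y := by
    funext i
    simp only [Pi.add_apply]
    split_ifs <;> ring
  map_smul' c x := by
    funext i
    simp only [Pi.smul_apply, smul_eq_mul, RingHom.id_apply]
    split_ifs <;> ring

/-- The boundary row is where the shape of `h_n` matters. In the kernel recursion, the correction
`α` at `k = n + 1` is `α` times the diagonal of `P̃_{n+1}`, and the correction `-1` at `k = n`
cancels the diagonal of `P̃_n`. -/
lemma PTilde_recursion_zero (n k : ℕ) :
    PTilde α (n + 2) 0 k + PTilde α n 0 k = α * PTilde α (n + 1) 0 k + PTilde α (n + 1) 1 k := by
  unfold PTilde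
  have e1 : ((n + 2 : ℕ) : ℤ) - (0 : ℕ) - k - 1 = ((n + 1 : ℕ) - (0 : ℕ) - k - 1 : ℤ) + 1 := by
    push_cast; ring
  have e2 : ((n + 1 : ℕ) : ℤ) - (1 : ℕ) - k - 1 = n - (0 : ℕ) - k - 1 := by push_cast; ring
  rw [e1, hankelKernel_add_one, e2]
  generalize hankelKernel α ((n : ℤ) - (0 : ℕ) - k - 1) = u
  generalize hankelKernel α ((n + 1 : ℕ) - (0 : ℕ) - k - 1 : ℤ) = v
  split_ifs <;> first | (exfalso; omega) | ring

/-- Away from the boundary the six terms on the two sides agree in pairs, for any kernel depending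
only on `n - i - k`. -/
lemma PTilde_recursion_succ (n i k : ℕ) :
    PTilde α (n + 2) (i + 1) k + PTilde α n (i + 1) k =
      PTilde α (n + 1) i k + PTilde α (n + 1) (i + 2) k := by
  unfold PTilde
  have e1 : ((n + 2 : ℕ) : ℤ) - (i + 1 : ℕ) - k - 1 = (n + 1 : ℕ) - i - k - 1 := by
    push_cast; ring
  have e2 : ((n + 1 : ℕ) : ℤ) - (i + 2 : ℕ) - k - 1 = n - (i + 1 : ℕ) - k - 1 := by
    push_cast; ring
  rw [e1, e2]
  have h1 : (k : ℤ) = (i + 1 : ℕ) + (n + 2 : ℕ) ↔ (k : ℤ) = (i + 2 : ℕ) + (n + 1 : ℕ) := by omega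
  have h2 : ((i + 1 : ℕ) : ℤ) = k + (n + 2 : ℕ) ↔ (i : ℤ) = k + (n + 1 : ℕ) := by omega
  have h3 : (k : ℤ) = (i + 1 : ℕ) + n ↔ (k : ℤ) = i + (n + 1 : ℕ) := by omega
  have h4 : ((i + 1 : ℕ) : ℤ) = k + n ↔ ((i + 2 : ℕ) : ℤ) = k + (n + 1 : ℕ) := by omega
  simp only [h1, h2, h3, h4]
  ring

lemma tridiag_zero (x : ℕ → ℂ) : tridiag α x 0 = α * x 0 + x 1 := by simp [tridiag]

lemma tridiag_succ (x : ℕ → ℂ) (i : ℕ) : tridiag α x (i + 1) = x i + x (i + 2) := by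
  simp [tridiag]

lemma PTilde_one_zero (k : ℕ) :
    PTilde α 1 0 k = α * (if k = 0 then 1 else 0) + (if k = 1 then 1 else 0) := by
  have h : (1 : ℕ) - (0 : ℕ) - (k : ℤ) - 1 = -k := by push_cast; ring
  rw [PTilde, h]
  rcases Nat.eq_zero_or_pos k with rfl | hk
  · simp [hankelKernel_zero]
  · rw [hankelKernel_of_neg α (by omega), if_neg (by omega : ¬ k = 0),
      if_neg (by omega : ¬ ((0 : ℕ) : ℤ) = k + (1 : ℕ))]
    simp

lemma PTilde_one_succ (i k : ℕ) :
    PTilde α 1 (i + 1) k = (if k = i then 1 else 0) + (if k = i + 2 then 1 else 0) := by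
  rw [PTilde, hankelKernel_of_neg α (by omega)]
  have h1 : (k : ℤ) = (i + 1 : ℕ) + (1 : ℕ) ↔ k = i + 2 := by omega
  have h2 : ((i + 1 : ℕ) : ℤ) = k + (1 : ℕ) ↔ k = i := by omega
  simp only [h1, h2]
  ring

-- Both sides satisfy `Y_{n+2} = P_1 Y_{n+1} - Y_n` with `Y_0 = 2I` and `Y_1 = P_1`. Row `i` of
-- `P̃_n` vanishes beyond column `i + n`, so the operators act on arbitrary sequences and any `N > i
-- + n` captures the whole row.
open Polynomial in
lemma aeval_tridiag_C (n : ℕ) (x : ℕ → ℂ) : ∀ i N : ℕ, i + n < N →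
    aeval (tridiag α) (Chebyshev.C ℂ n) x i = ∑ k ∈ Finset.range N, PTilde α n i k * x k := by
  induction n using Nat.twoStepInduction with
  | zero =>
    intro i N hN
    have : i < N := by omega
    have h2 : aeval (tridiag α) (2 : ℂ[X]) = 2 := map_ofNat _ 2
    simp [PTilde_zero, Matrix.one_apply, this, h2, Module.End.ofNat_apply]
  | one =>
    intro i N hN
    rcases i with _ | i
    · have h0 : 0 < N := by omega
      have h1 : 1 < N := by omega
      simp [PTilde_one_zero, tridiag_zero, add_mul, Finset.sum_add_distrib, h0, h1]
    · have h0 : i < N := by omega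
      have h1 : i + 2 < N := by omega
      simp [PTilde_one_succ, tridiag_succ, add_mul, Finset.sum_add_distrib, h0, h1]
  | more n ih0 ih1 =>
    intro i N hN
    have h : aeval (tridiag α) (Chebyshev.C ℂ ((n + 2 : ℕ) : ℤ)) x i =
        tridiag α (aeval (tridiag α) (Chebyshev.C ℂ ((n + 1 : ℕ) : ℤ)) x) i -
        aeval (tridiag α) (Chebyshev.C ℂ n) x i := by
      push_cast
      rw [Chebyshev.C_add_two, map_sub, map_mul, aeval_X]
      rfl
    rw [h, ih0 i N (by omega)]
    rcases i with _ | i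
    · rw [tridiag_zero, ih1 0 N (by omega), ih1 1 N (by omega), Finset.mul_sum,
        ← Finset.sum_add_distrib, ← Finset.sum_sub_distrib]
      refine Finset.sum_congr rfl fun k _ => ?_
      linear_combination (-x k) * PTilde_recursion_zero α n k
    · rw [tridiag_succ, ih1 i N (by omega), ih1 (i + 2) N (by omega),
        ← Finset.sum_add_distrib, ← Finset.sum_sub_distrib]
      refine Finset.sum_congr rfl fun k _ => ?_
      linear_combination (-x k) * PTilde_recursion_succ α n i k

open Polynomial in
lemma aeval_tridiag_C_single (n i j : ℕ) :
    aeval (tridiag α) (Chebyshev.C ℂ n) (Pi.single j 1) i = PTilde α n i j := by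
  rw [aeval_tridiag_C α n _ i (i + n + j + 1) (by omega)]
  have : j < i + n + j + 1 := by omega
  simp [Pi.single_apply, this]

/-- `P̃_m P̃_n = P̃_{m+n} + P̃_{|m-n|}`. -/
lemma sum_PTilde_mul_PTilde {m n i j K : ℕ} (hK : i + m < K) :
    ∑ k ∈ Finset.range K, PTilde α m i k * PTilde α n k j =
      PTilde α (m + n) i j + PTilde α ((m : ℤ) - n).natAbs i j := by
  rw [← aeval_tridiag_C_single α (m + n), ← aeval_tridiag_C_single α ((m : ℤ) - n).natAbs,
    Polynomial.Chebyshev.C_natAbs, Nat.cast_add]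
  have := Polynomial.Chebyshev.C_mul_C ℂ m n
  rw [← Pi.add_apply, ← LinearMap.add_apply, ← map_add, ← this, map_mul, Module.End.mul_apply,
    aeval_tridiag_C α m _ i K hK]
  simp_rw [aeval_tridiag_C_single]

/-! #### Bounds for the partial sums -/

/-- A discrete primitive of `(p, q) ↦ g(p) g(q)` along the diagonal. -/
def kernelPrimitive (p q : ℤ) : ℂ :=
  (if 0 ≤ p ∧ 0 ≤ q then (α ^ 2 - 1) * α ^ (p + q).toNat else 0) -
    (if p = q ∧ p < 0 then 1 else 0)

/-- For `p, q ≥ 1` this is `(α²-1)² α^(p+q-2) = (α²-1)(α^(p+q) - α^(p+q-2))`. The value `-1` on the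
negative diagonal accounts for `p = q = 0`, where `α² = (α²-1) + 1`. -/
lemma kernelPrimitive_sub (p q : ℤ) : kernelPrimitive α p q - kernelPrimitive α (p - 1) (q - 1) =
    hankelKernel α p * hankelKernel α q := by
  unfold kernelPrimitive
  rcases lt_trichotomy p 0 with hp | rfl | hp
  · rw [hankelKernel_of_neg α hp]
    split_ifs <;> first | (exfalso; omega) | ring
  · rw [hankelKernel_zero]
    rcases lt_trichotomy q 0 with hq | rfl | hq
    · rw [hankelKernel_of_neg α hq, if_neg (by omega), if_neg (by omega), if_neg (by omega),
        if_neg (by omega)]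
      ring
    · rw [hankelKernel_zero]
      simp
      ring
    · obtain ⟨t, rfl⟩ : ∃ t : ℕ, q = t + 1 := ⟨(q - 1).toNat, by omega⟩
      rw [hankelKernel_natCast_add_one, if_pos (by omega), if_neg (by omega), if_neg (by omega),
        if_neg (by omega), show (0 + ((t : ℤ) + 1)).toNat = t + 1 by omega]
      ring
  · obtain ⟨s, rfl⟩ : ∃ t : ℕ, p = t + 1 := ⟨(p - 1).toNat, by omega⟩
    rw [hankelKernel_natCast_add_one]
    rcases lt_trichotomy q 0 with hq | rfl | hq
    · rw [hankelKernel_of_neg α hq, if_neg (by omega), if_neg (by omega), if_neg (by omega),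
        if_neg (by omega)]
      ring
    · rw [hankelKernel_zero, if_pos (by omega), if_neg (by omega), if_neg (by omega),
        if_neg (by omega), show (((s : ℤ) + 1) + 0).toNat = s + 1 by omega]
      ring
    · obtain ⟨t, rfl⟩ : ∃ t : ℕ, q = t + 1 := ⟨(q - 1).toNat, by omega⟩
      rw [hankelKernel_natCast_add_one, if_pos (by omega), if_neg (by omega), if_pos (by omega),
        if_neg (by omega), show ((s : ℤ) + 1 + (t + 1)).toNat = s + t + 2 by omega,
        show ((s : ℤ) + 1 - 1 + (t + 1 - 1)).toNat = s + t by omega]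
      ring

lemma sum_hankelKernel_mul (p q : ℤ) (K : ℕ) :
    ∑ k ∈ Finset.range K, hankelKernel α (p - k) * hankelKernel α (q - k) =
      kernelPrimitive α p q - kernelPrimitive α (p - K) (q - K) := by
  induction K with
  | zero => simp
  | succ K ih =>
    rw [Finset.sum_range_succ, ih, ← kernelPrimitive_sub, Nat.cast_succ, sub_sub p, sub_sub q]
    ring

lemma norm_kernelPrimitive_le {p q : ℤ} {m n : ℕ} (hp : p ≤ m) (hq : q ≤ n) :
    ‖kernelPrimitive α p q‖ ≤ (‖α ^ 2 - 1‖ + 1) * max 1 ‖α‖ ^ (m + n) := by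
  have h1 : 1 ≤ max 1 ‖α‖ ^ (m + n) := one_le_pow₀ (le_max_left _ _)
  have h0 := norm_nonneg (α ^ 2 - 1)
  unfold kernelPrimitive
  by_cases h : 0 ≤ p ∧ 0 ≤ q
  · rw [if_pos h, if_neg (by omega), sub_zero, norm_mul, norm_pow]
    have h2 : ‖α‖ ^ (p + q).toNat ≤ max 1 ‖α‖ ^ (m + n) :=
      (pow_le_pow_left₀ (norm_nonneg _) (le_max_right _ _) _).trans
        (pow_le_pow_right₀ (le_max_left _ _) (by omega))
    nlinarith [mul_le_mul_of_nonneg_left h2 h0]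
  · rw [if_neg h]
    have h3 : ‖(if p = q ∧ p < 0 then 1 else 0 : ℂ)‖ ≤ 1 := by split_ifs <;> simp
    rw [zero_sub, norm_neg]
    nlinarith

lemma norm_sum_ite_le {B : ℝ} (hB : 0 ≤ B) (x : ℕ → ℂ) (hx : ∀ k, ‖x k‖ ≤ B) (P : ℕ → Prop)
    [DecidablePred P] (hP : ∀ k l, P k → P l → k = l) (K : ℕ) :
    ‖∑ k ∈ Finset.range K, (if P k then 1 else 0) * x k‖ ≤ B := by
  by_cases h : ∃ k ∈ Finset.range K, P k
  · obtain ⟨k, hk, hPk⟩ := h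
    rw [Finset.sum_eq_single k]
    · simpa [hPk] using hx k
    · intro l _ hlk
      rw [if_neg fun hl => hlk (hP l k hl hPk), zero_mul]
    · exact fun h => absurd hk h
  · push Not at h
    rw [Finset.sum_eq_zero fun k hk => by rw [if_neg (h k hk), zero_mul]]
    simpa

/-- Uniformity in `K` makes this the dominating bound for products of series. Estimating the
Hankel-Hankel part term by term could cost a factor `min(m, n)` when `|α| = 1`; telescoping with
`kernelPrimitive` avoids it. -/
lemma exists_norm_sum_PTilde_le : ∃ C, 0 ≤ C ∧ ∀ i j m n K : ℕ,
    ‖∑ k ∈ Finset.range K, PTilde α m i k * PTilde α n k j‖ ≤ C * max 1 ‖α‖ ^ (m + n) := by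
  set B := 2 + ‖α‖ + ‖α ^ 2 - 1‖ with hB
  have hB0 : 0 ≤ B := by positivity
  refine ⟨4 * B + 2 * (‖α ^ 2 - 1‖ + 1), by positivity, fun i j m n K => ?_⟩
  set R := max 1 ‖α‖ with hR
  have hR1 : 1 ≤ R := le_max_left _ _
  have hmn : ∀ k l : ℕ, k ≤ m + n → B * R ^ k ≤ B * R ^ (m + n) := fun k l hk =>
    mul_le_mul_of_nonneg_left (pow_le_pow_right₀ hR1 hk) hB0
  have hP : ∀ k, ‖PTilde α n k j‖ ≤ B * R ^ (m + n) := fun k =>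
    (norm_PTilde_le α n k j).trans (hmn n 0 (by omega))
  have hG : ∀ k : ℕ, ‖hankelKernel α (m - i - k - 1)‖ ≤ B * R ^ (m + n) := fun k => by
    refine (norm_hankelKernel_le α (n := m) (by omega)).trans ?_
    refine le_trans ?_ (hmn m 0 (by omega))
    rw [hB]
    gcongr
    linarith
  -- Only the last of these five products is a genuine sum over `k`; an indicator in each of the
  -- others selects at most one index.
  have e : ∀ k : ℕ, PTilde α m i k * PTilde α n k j =
      (if (k : ℤ) = i + m then 1 else 0) * PTilde α n k j +
      (if (i : ℤ) = k + m then 1 else 0) * PTilde α n k j +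
      (if (j : ℤ) = k + n then 1 else 0) * hankelKernel α (m - i - k - 1) +
      (if (k : ℤ) = j + n then 1 else 0) * hankelKernel α (m - i - k - 1) +
      hankelKernel α ((m - i - 1 : ℤ) - k) * hankelKernel α ((n - j - 1 : ℤ) - k) := fun k => by
    rw [PTilde, show (m : ℤ) - i - 1 - k = m - i - k - 1 by ring,
      show (n : ℤ) - j - 1 - k = n - k - j - 1 by ring, PTilde]
    ring
  simp_rw [e, Finset.sum_add_distrib]
  rw [sum_hankelKernel_mul]
  have hBR : 0 ≤ B * R ^ (m + n) := by positivity
  have b1 := norm_sum_ite_le hBR _ hP (fun k : ℕ => (k : ℤ) = i + m) (by intros; omega) K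
  have b2 := norm_sum_ite_le hBR _ hP (fun k : ℕ => (i : ℤ) = k + m) (by intros; omega) K
  have b3 := norm_sum_ite_le hBR _ hG (fun k : ℕ => (j : ℤ) = k + n) (by intros; omega) K
  have b4 := norm_sum_ite_le hBR _ hG (fun k : ℕ => (k : ℤ) = j + n) (by intros; omega) K
  have b5 := norm_kernelPrimitive_le α (p := m - i - 1) (q := n - j - 1) (m := m) (n := n)
    (by omega) (by omega)
  have b6 := norm_kernelPrimitive_le α (p := m - i - 1 - K) (q := n - j - 1 - K) (m := m) (n := n)
    (by omega) (by omega)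
  refine (norm_add_le _ _).trans ((add_le_add ((norm_add_le _ _).trans (add_le_add
    ((norm_add_le _ _).trans (add_le_add ((norm_add_le _ _).trans (add_le_add b1 b2)) b3)) b4))
    ((norm_sub_le _ _).trans (add_le_add b5 b6))).trans ?_)
  rw [← hR]
  linarith

end Matrices

/-! ### Multiplicativity of `P_α` -/

/-- The matrices `Q_n = P̃_|n| / 2`, so that `P_α(a) = ∑_{n ∈ ℤ} a_n Q_n`. -/
def PHalf (α : ℂ) (n : ℤ) (i j : ℕ) : ℂ := PTilde α n.natAbs i j / 2

lemma PHalf_neg (α : ℂ) (n : ℤ) (i j : ℕ) : PHalf α (-n) i j = PHalf α n i j := by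
  simp [PHalf]

lemma exists_norm_PHalf_le (α : ℂ) : ∃ B, 0 ≤ B ∧ ∀ n i j,
    ‖PHalf α n i j‖ ≤ B * max 1 ‖α‖ ^ n.natAbs := by
  refine ⟨2 + ‖α‖ + ‖α ^ 2 - 1‖, by positivity, fun n i j => ?_⟩
  have := norm_PTilde_le α n.natAbs i j
  rw [PHalf, norm_div, Complex.norm_ofNat]
  linarith [norm_nonneg (PTilde α n.natAbs i j)]

lemma sum_PHalf_mul_PHalf (α : ℂ) {m n : ℤ} {i j K : ℕ} (hK : i + m.natAbs < K) :
    ∑ k ∈ Finset.range K, PHalf α m i k * PHalf α n k j =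
      (PHalf α (m + n) i j + PHalf α (m - n) i j) / 2 := by
  have h := sum_PTilde_mul_PTilde α (n := n.natAbs) (j := j) hK
  -- The numbers `|m| + |n|` and `||m| - |n||` are `|m + n|` and `|m - n|`, in an order depending on
  -- the signs.
  have e : PTilde α (m.natAbs + n.natAbs) i j + PTilde α ((m.natAbs : ℤ) - n.natAbs).natAbs i j =
      PTilde α (m + n).natAbs i j + PTilde α (m - n).natAbs i j := by
    rcases le_total 0 m with hm | hm <;> rcases le_total 0 n with hn | hn
    · congr 2 <;> omega
    · rw [add_comm]; congr 2 <;> omega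
    · rw [add_comm]; congr 2 <;> omega
    · congr 2 <;> omega
  rw [e] at h
  simp only [PHalf]
  rw [← add_div, ← h, Finset.sum_div, Finset.sum_div]
  exact Finset.sum_congr rfl fun k _ => by ring

section

variable {α : ℂ} {a b : Circle → ℂ} {c d : ℤ → ℂ}

lemma IsCoeffs.summable_norm_mul_PHalf (ha : IsCoeffs (max 1 ‖α‖) a c) (i j : ℕ) :
    Summable fun n => ‖c n * PHalf α n i j‖ := by
  obtain ⟨B, hB, h⟩ := exists_norm_PHalf_le α
  refine Summable.of_nonneg_of_le (fun n => norm_nonneg _) (fun n => ?_) (ha.summable.mul_left B)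
  rw [norm_mul]
  calc _ ≤ ‖c n‖ * (B * max 1 ‖α‖ ^ n.natAbs) := by gcongr; exact h n i j
    _ = _ := by ring

lemma IsCoeffs.hasSum_PBasis (ha : IsCoeffs (max 1 ‖α‖) a c) (i j : ℕ) :
    HasSum (fun n : ℕ => laurentCoeff a n * PBasis α n i j) (∑' n, c n * PHalf α n i j) := by
  -- Pairing `n` with `-n` counts the term `n = 0` twice, so it is subtracted once.
  have h := ((ha.summable_norm_mul_PHalf i j).of_norm.hasSum.nat_add_neg).sub
    (hasSum_ite_eq (0 : ℕ) (c 0 * PHalf α 0 i j))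
  rw [add_sub_cancel_right] at h
  refine h.congr_fun fun n => ?_
  rw [ha.laurentCoeff_eq (le_max_left _ _), PHalf_neg, ha.symm]
  rcases eq_or_ne n 0 with rfl | hn
  · simp [PHalf, PTilde_zero, PBasis]
  · simp [PHalf, PBasis_eq_PTilde α hn, hn]
    ring

lemma IsCoeffs.PAlpha_apply (ha : IsCoeffs (max 1 ‖α‖) a c) (i j : ℕ) :
    PAlpha α a i j = ∑' n, c n * PHalf α n i j :=
  (ha.hasSum_PBasis i j).tsum_eq

lemma IsCoeffs.hasSum_PAlpha (ha : IsCoeffs (max 1 ‖α‖) a c) (i j : ℕ) :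
    HasSum (fun n => c n * PHalf α n i j) (PAlpha α a i j) := by
  rw [ha.PAlpha_apply]
  exact (ha.summable_norm_mul_PHalf i j).of_norm.hasSum

lemma IsCoeffs.tsum_mul_PHalf_add (ha : IsCoeffs (max 1 ‖α‖) a c) (hb : IsCoeffs (max 1 ‖α‖) b d)
    (i j : ℕ) : HasSum (fun p : ℤ × ℤ => c p.1 * d p.2 * PHalf α (p.1 + p.2) i j)
      (PAlpha α (a * b) i j) := by
  have hρ : 1 ≤ max 1 ‖α‖ := le_max_left _ _
  obtain ⟨B, hB, h⟩ := exists_norm_PHalf_le α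
  have hs : Summable fun p : ℤ × ℤ => c p.1 * d p.2 * PHalf α (p.1 + p.2) i j := by
    refine Summable.of_norm_bounded
      ((summable_weight_mul hρ ha.summable hb.summable).mul_left B) fun p => ?_
    rw [norm_mul, norm_mul]
    calc _ ≤ ‖c p.1‖ * ‖d p.2‖ * (B * (max 1 ‖α‖ ^ p.1.natAbs * max 1 ‖α‖ ^ p.2.natAbs)) := by
          gcongr
          exact (h _ i j).trans (by gcongr; exact pow_natAbs_add_le hρ _ _)
      _ = _ := by ring
  have h1 := hasSum_conv hρ ha.summable hb.summable (φ := fun l => PHalf α l i j) hs.hasSum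
  rw [(ha.mul hρ hb).PAlpha_apply, h1.tsum_eq]
  exact hs.hasSum

/-- `P_α(a) P_α(b) = P_α(ab)`. -/
theorem IsCoeffs.isProd_PAlpha (ha : IsCoeffs (max 1 ‖α‖) a c) (hb : IsCoeffs (max 1 ‖α‖) b d) :
    IsProd (PAlpha α a) (PAlpha α b) (PAlpha α (a * b)) := by
  intro i j
  have hρ : 1 ≤ max 1 ‖α‖ := le_max_left _ _
  have h1 : ∀ K : ℕ, HasSum (fun p : ℤ × ℤ => c p.1 * d p.2 *
      ∑ k ∈ Finset.range K, PHalf α p.1 i k * PHalf α p.2 k j)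
      (∑ k ∈ Finset.range K, PAlpha α a i k * PAlpha α b k j) := by
    intro K
    have h := hasSum_sum (s := Finset.range K) fun k _ => hasSum_mul_of_summable_norm
      (ha.hasSum_PAlpha i k) (hb.hasSum_PAlpha k j) (ha.summable_norm_mul_PHalf i k)
      (hb.summable_norm_mul_PHalf k j)
    convert h using 2 with p
    rw [Finset.mul_sum]
    exact Finset.sum_congr rfl fun k _ => by ring
  have h2 : HasSum (fun p : ℤ × ℤ => c p.1 * d p.2 *
      ((PHalf α (p.1 + p.2) i j + PHalf α (p.1 - p.2) i j) / 2)) (PAlpha α (a * b) i j) := by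
    have h3 := ha.tsum_mul_PHalf_add hb i j
    -- Since `d` is even, replacing `n` by `-n` shows that the `m - n` half has the same sum as the
    -- `m + n` half.
    have h4 := ((Equiv.refl ℤ).prodCongr (Equiv.neg ℤ)).hasSum_iff.2 h3
    have h5 := (h3.add h4).div_const 2
    rw [add_self_div_two] at h5
    refine h5.congr_fun fun p => ?_
    simp only [Function.comp_def, Equiv.prodCongr_apply, Equiv.coe_refl, Prod.map_fst, id_eq,
      Prod.map_snd, Equiv.neg_apply, hb.symm, ← sub_eq_add_neg]
    ring
  rw [← h2.tsum_eq]
  simp_rw [← fun K => (h1 K).tsum_eq]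
  -- The limit in `K` is exchanged with the sum over `(m, n)`: each truncated product is constant
  -- once `K > i + |m|`.
  obtain ⟨C, hC, h⟩ := exists_norm_sum_PTilde_le α
  refine tendsto_tsum_of_dominated_convergence
    ((summable_weight_mul hρ ha.summable hb.summable).mul_left (C / 4)) (fun p => ?_)
    (.of_forall fun K p => ?_)
  · refine tendsto_const_nhds.congr' ?_
    filter_upwards [eventually_gt_atTop (i + p.1.natAbs)] with K hK
    rw [sum_PHalf_mul_PHalf α hK]
  · have e : ∑ k ∈ Finset.range K, PHalf α p.1 i k * PHalf α p.2 k j =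
        (∑ k ∈ Finset.range K, PTilde α p.1.natAbs i k * PTilde α p.2.natAbs k j) / 4 := by
      rw [Finset.sum_div]
      exact Finset.sum_congr rfl fun k _ => by unfold PHalf; ring
    rw [norm_mul, norm_mul, e, norm_div, Complex.norm_ofNat, ← pow_add]
    calc _ ≤ ‖c p.1‖ * ‖d p.2‖ * (C * max 1 ‖α‖ ^ (p.1.natAbs + p.2.natAbs) / 4) := by
          gcongr
          exact h i j _ _ K
      _ = _ := by ring

end

namespace Admissible

variable {α : ℂ} {a b : Circle → ℂ}

lemma converges (ha : Admissible α a) : PAlphaConverges α a := by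
  obtain ⟨c, hc⟩ := ha.exists_isCoeffs
  exact fun i j => (hc.hasSum_PBasis i j).summable

lemma isProd (ha : Admissible α a) (hb : Admissible α b) :
    IsProd (PAlpha α a) (PAlpha α b) (PAlpha α (a * b)) := by
  obtain ⟨c, hc⟩ := ha.exists_isCoeffs
  obtain ⟨d, hd⟩ := hb.exists_isCoeffs
  exact hc.isProd_PAlpha hd

lemma PAlpha_add (ha : Admissible α a) (hb : Admissible α b) :
    PAlpha α (a + b) = PAlpha α a + PAlpha α b := by
  obtain ⟨c, hc⟩ := ha.exists_isCoeffs
  obtain ⟨d, hd⟩ := hb.exists_isCoeffs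
  funext i j
  refine ((hc.add hd (by positivity)).hasSum_PAlpha i j).unique ?_
  simpa [add_mul] using (hc.hasSum_PAlpha i j).add (hd.hasSum_PAlpha i j)

end Admissible

lemma PAlpha_const (α k : ℂ) : PAlpha α (fun _ => k) = k • (1 : Matrix ℕ ℕ ℂ) := by
  funext i j
  refine ((IsCoeffs.const (max 1 ‖α‖) k).hasSum_PAlpha i j).unique ?_
  refine (hasSum_ite_eq (0 : ℤ) (k * (1 : Matrix ℕ ℕ ℂ) i j)).congr_fun fun n => ?_
  split_ifs with h
  · simp [h, PHalf, PTilde_zero]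
  · simp

lemma PAlpha_one (α : ℂ) : PAlpha α 1 = 1 :=
  (PAlpha_const α 1).trans (one_smul _ _)

lemma Admissible.PAlpha_smul {α : ℂ} {a : Circle → ℂ} (ha : Admissible α a) (k : ℂ) :
    PAlpha α (k • a) = k • PAlpha α a := by
  obtain ⟨c, hc⟩ := ha.exists_isCoeffs
  funext i j
  refine ((hc.smul k).hasSum_PAlpha i j).unique ?_
  simpa [mul_assoc] using (hc.hasSum_PAlpha i j).mul_left k

/-! ### Wiener's lemma -/

/-- In a commutative Banach algebra, a Laurent series in an invertible element whose integer powers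
have norm at most `1` is invertible if its symbol has no zero on the unit circle. -/
lemma isUnit_tsum_smul {A : Type*} [NormedRing A] [NormedAlgebra ℂ A] [CompleteSpace A]
    (hcomm : ∀ x y : A, x * y = y * x) (u : ℤ → A) (h0 : u 0 = 1)
    (hadd : ∀ m n, u (m + n) = u m * u n) (hu : ∀ n, ‖u n‖ ≤ 1)
    {c : ℤ → ℂ} (hc : Summable fun i => ‖c i‖) {a : Circle → ℂ}
    (ha : ∀ z : Circle, HasSum (fun i : ℤ => c i * (z : ℂ) ^ i) (a z)) (hne : ∀ z, a z ≠ 0) :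
    IsUnit (∑' i, c i • u i) := by
  let _ : NormedCommRing A := { ‹NormedRing A› with mul_comm := hcomm }
  by_contra hunit
  -- A non-unit is killed by some character; the aim is to recognize the value of that character as
  -- some `a z`.
  obtain ⟨φ, hφ⟩ := WeakDual.CharacterSpace.exists_apply_eq_zero hunit
  have h1 : ‖(1 : A)‖ ≤ 1 := h0 ▸ hu 0
  have hle : ∀ n, ‖φ (u n)‖ ≤ 1 := fun n =>
    (AlgHom.norm_apply_le_self_mul_norm_one φ (u n)).trans
      (mul_le_one₀ (hu n) (norm_nonneg _) h1)
  have hmul : φ (u 1) * φ (u (-1)) = 1 := by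
    rw [← map_mul, ← hadd, add_neg_cancel, h0, map_one]
  -- Both `φ(u 1)` and its inverse `φ(u (-1))` lie in the closed unit disc.
  have hnorm : ‖φ (u 1)‖ = 1 := by
    refine le_antisymm (hle 1) ?_
    have h2 : ‖φ (u 1)‖ * ‖φ (u (-1))‖ = 1 := by rw [← norm_mul, hmul, norm_one]
    nlinarith [hle (-1), norm_nonneg (φ (u 1))]
  obtain ⟨z, hz⟩ : ∃ z : Circle, (z : ℂ) = φ (u 1) :=
    ⟨⟨φ (u 1), by simpa [Submonoid.unitSphere] using hnorm⟩, rfl⟩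
  have hpow : ∀ n : ℤ, φ (u n) = (z : ℂ) ^ n := by
    intro n
    induction n using Int.induction_on with
    | zero => simp [h0]
    | succ i ih => rw [hadd, map_mul, ih, ← hz, zpow_add_one₀ z.coe_ne_zero]
    | pred i ih =>
      rw [sub_eq_add_neg, hadd, map_mul, ih, ← sub_eq_add_neg, zpow_sub_one₀ z.coe_ne_zero,
        hz, eq_inv_of_mul_eq_one_right hmul]
  have hs : Summable fun i => c i • u i := Summable.of_norm_bounded hc fun i => by
    rw [norm_smul]
    exact mul_le_of_le_one_right (norm_nonneg _) (hu i)
  have h3 := hs.hasSum.mapL (WeakDual.toStrongDual (φ : WeakDual ℂ A))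
  refine hne z ((ha z).unique ?_)
  have h4 : ∀ x, WeakDual.toStrongDual (φ : WeakDual ℂ A) x = φ x := fun _ => rfl
  simp only [h4, hφ, map_smul, hpow, smul_eq_mul] at h3
  exact h3

/-- The sequence space `ℓ¹(ℤ)`. -/
abbrev EllOneInt := lp (fun _ : ℤ => ℂ) 1

lemma EllOneInt.summable_norm (x : EllOneInt) : Summable fun i => ‖x i‖ := by
  simpa using (memℓp_gen_iff (p := 1) (by simp)).1 (lp.memℓp x)

lemma EllOneInt.norm_eq (x : EllOneInt) : ‖x‖ = ∑' i, ‖x i‖ := by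
  simpa using lp.norm_eq_tsum_rpow (p := 1) (by simp) x

/-- The translation `x ↦ (x_{n - k})_n` of `ℓ¹(ℤ)`. -/
def translate (k : ℤ) : EllOneInt →L[ℂ] EllOneInt :=
  LinearMap.mkContinuous
    { toFun := fun x => ⟨fun n => x (n - k), memℓp_gen (by
        simpa [Function.comp_def] using (Equiv.subRight k).summable_iff.2 (EllOneInt.summable_norm x))⟩
      map_add' := fun x y => rfl
      map_smul' := fun c x => rfl } 1 fun x => by
    rw [one_mul, EllOneInt.norm_eq, EllOneInt.norm_eq]
    exact ((Equiv.subRight k).tsum_eq fun i => ‖x i‖).le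

lemma translate_apply (k : ℤ) (x : EllOneInt) (n : ℤ) : translate k x n = x (n - k) := rfl

lemma norm_translate_le (k : ℤ) : ‖translate k‖ ≤ 1 :=
  LinearMap.mkContinuous_norm_le _ zero_le_one _

lemma translate_zero : translate 0 = 1 := by
  ext x n
  simp [translate_apply]

lemma translate_add (j k : ℤ) : translate (j + k) = translate j * translate k := by
  ext x n
  rw [mul_apply_eq_comp, translate_apply, translate_apply, translate_apply, sub_sub]

/-- The closed algebra generated by the translations. -/
abbrev translationAlgebra : Subalgebra ℂ (EllOneInt →L[ℂ] EllOneInt) :=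
  (Algebra.adjoin ℂ (Set.range translate)).topologicalClosure

lemma translate_mem (k : ℤ) : translate k ∈ translationAlgebra :=
  Subalgebra.le_topologicalClosure _ (Algebra.subset_adjoin ⟨k, rfl⟩)

lemma translationAlgebra_mul_comm (x y : translationAlgebra) : x * y = y * x := by
  have h := Algebra.isMulCommutative_adjoin ℂ (s := Set.range translate) (by
    rintro _ ⟨j, rfl⟩ _ ⟨k, rfl⟩
    rw [← translate_add, ← translate_add, add_comm])
  exact (Subalgebra.commRingTopologicalClosure _ fun x y => h.is_comm.comm x y).mul_comm x y

instance : CompleteSpace translationAlgebra :=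
  (Subalgebra.isClosed_topologicalClosure _).completeSpace_coe

/-- **Wiener's lemma**, for coefficient sequences. -/
lemma exists_conv_eq_single {c : ℤ → ℂ} (hc : Summable fun i => ‖c i‖) {a : Circle → ℂ}
    (ha : ∀ z : Circle, HasSum (fun i : ℤ => c i * (z : ℂ) ^ i) (a z)) (hne : ∀ z, a z ≠ 0) :
    ∃ d : ℤ → ℂ, (Summable fun i => ‖d i‖) ∧ conv c d = Pi.single 0 1 := by
  let u : ℤ → translationAlgebra := fun k => ⟨translate k, translate_mem k⟩
  have hu : ∀ n, ‖u n‖ ≤ 1 := norm_translate_le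
  have hunit := isUnit_tsum_smul translationAlgebra_mul_comm u (Subtype.ext translate_zero)
    (fun m n => Subtype.ext (translate_add m n)) hu hc ha hne
  obtain ⟨b, hb⟩ := hunit.exists_right_inv
  have hs : Summable fun i => c i • u i := Summable.of_norm_bounded hc fun i => by
    rw [norm_smul]
    exact mul_le_of_le_one_right (norm_nonneg _) (hu i)
  -- The inverse operator applied to the unit sequence at `0` is the convolution inverse, and it
  -- lies in `ℓ¹` by construction.
  set x : EllOneInt := (b : EllOneInt →L[ℂ] EllOneInt) (lp.single 1 0 1) with hx
  refine ⟨x, (EllOneInt.summable_norm x), funext fun n => ?_⟩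
  have h1 := hs.hasSum.mapL (translationAlgebra.val.toLinearMap.mkContinuous 1 fun y => by
    rw [one_mul]; exact le_rfl)
  have h2 := (h1.mapL (ContinuousLinearMap.apply ℂ EllOneInt x)).mapL
    (lp.evalCLM (𝕜 := ℂ) (fun _ : ℤ => ℂ) 1 n)
  have h3 : HasSum (fun k => c k * x (n - k))
      (((∑' i, c i • u i : translationAlgebra) : EllOneInt →L[ℂ] EllOneInt) x n) := h2
  have h4 : ((∑' i, c i • u i : translationAlgebra) : EllOneInt →L[ℂ] EllOneInt) x =
      lp.single 1 0 1 :=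
    congrArg (fun y : translationAlgebra =>
      (y : EllOneInt →L[ℂ] EllOneInt) (lp.single 1 0 1)) hb
  rw [h4] at h3
  rw [conv, h3.tsum_eq, lp.coeFn_single]

/-- Wiener's lemma as stated does not give symmetric coefficients. Because `a(1/z) = a(z)`, the
reflected sequence also represents `1/a`, and the average of the two is symmetric. -/
lemma MemWS.inv {a : Circle → ℂ} (ha : MemWS a) (hne : ∀ z, a z ≠ 0) :
    MemWS fun z => (a z)⁻¹ := by
  obtain ⟨c, hc, hsymm, hsum⟩ := ha
  obtain ⟨d, hd, hcd⟩ := exists_conv_eq_single hc hsum hne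
  have hinv : ∀ z : Circle, HasSum (fun i : ℤ => d i * (z : ℂ) ^ i) (a z)⁻¹ := by
    intro z
    have h1 : Summable fun i : ℤ => d i * (z : ℂ) ^ i :=
      Summable.of_norm (by simpa [Circle.norm_coe] using hd)
    have h2 := hasSum_conv_zpow hc hd (hsum z) h1.hasSum
    rw [hcd] at h2
    have h3 := h2.unique (hasSum_single 0 fun n hn => by simp [hn])
    rw [Pi.single_eq_same, zpow_zero, mul_one] at h3
    rw [← eq_inv_of_mul_eq_one_right h3]
    exact h1.hasSum
  have hneg : ∀ z : Circle, a z⁻¹ = a z := by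
    intro z
    refine (hsum z⁻¹).unique ?_
    have h1 := (Equiv.neg ℤ).hasSum_iff.2 (hsum z)
    refine h1.congr_fun fun n => ?_
    simp [hsymm]
  have hinv' : ∀ z : Circle, HasSum (fun i : ℤ => d (-i) * (z : ℂ) ^ i) (a z)⁻¹ := by
    intro z
    rw [← hneg]
    have h1 := (Equiv.neg ℤ).hasSum_iff.2 (hinv z⁻¹)
    refine h1.congr_fun fun n => ?_
    simp
  refine ⟨fun i => (d i + d (-i)) / 2, ?_, fun i => by simp [add_comm], fun z => ?_⟩
  · refine Summable.of_nonneg_of_le (fun _ => norm_nonneg _) (fun i => ?_)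
      (hd.add ((Equiv.neg ℤ).summable_iff.2 hd))
    rw [norm_div, Complex.norm_ofNat]
    have := norm_add_le (d i) (d (-i))
    simp only [Function.comp_apply, Equiv.neg_apply]
    linarith [norm_nonneg (d i + d (-i))]
  · have h := ((hinv z).add (hinv' z)).div_const 2
    rw [add_self_div_two] at h
    exact h.congr_fun fun i => by ring

/-! ### Operators given by matrices -/

section Operators

variable {p : ℝ≥0∞} [Fact (1 ≤ p)] {M N R : Matrix ℕ ℕ ℂ} {A B : Ell p →L[ℂ] Ell p}

lemma IsMatrixOf.unique (hA : IsMatrixOf M A) (hB : IsMatrixOf M B) : A = B := by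
  ext x i
  exact (hA x i).unique (hB x i)

lemma isMatrixOf_one : IsMatrixOf (1 : Matrix ℕ ℕ ℂ) (1 : Ell p →L[ℂ] Ell p) := by
  intro x i
  convert hasSum_single i ?_ using 1
  · simp
  · intro j hj
    simp [Matrix.one_apply_ne hj.symm]

lemma IsMatrixOf.add (hA : IsMatrixOf M A) (hB : IsMatrixOf N B) :
    IsMatrixOf (M + N) (A + B) := by
  intro x i
  simpa [add_mul] using (hA x i).add (hB x i)

lemma IsMatrixOf.smul (hA : IsMatrixOf M A) (k : ℂ) : IsMatrixOf (k • M) (k • A) := by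
  intro x i
  simpa [mul_assoc] using (hA x i).mul_left k

lemma IsMatrixOf.apply_single (hA : IsMatrixOf M A) (i j : ℕ) :
    A (lp.single p j 1) i = M i j := by
  refine (hA _ i).unique ?_
  convert hasSum_single j ?_ using 1
  · simp
  · intro k hk
    simp [hk]

/-- The rows of the matrix of a bounded operator on `ℓ^∞` are absolutely summable. -/
lemma IsMatrixOf.sum_norm_le {A : Ell ⊤ →L[ℂ] Ell ⊤} (hA : IsMatrixOf M A) (i : ℕ) :
    (Summable fun j => ‖M i j‖) ∧ ∑' j, ‖M i j‖ ≤ ‖A‖ := by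
  -- The test vector carries the conjugate phases of row `i`; where the entry is zero, division by
  -- zero makes its coordinate `0`.
  have hx : ∀ j, ‖(starRingEnd ℂ) (M i j) / ‖M i j‖‖ ≤ 1 := fun j => by
    rw [norm_div, RCLike.norm_conj, Complex.norm_real, norm_norm]
    exact div_self_le_one _
  let x : Ell ⊤ := ⟨fun j => (starRingEnd ℂ) (M i j) / ‖M i j‖,
    memℓp_infty ⟨1, by rintro _ ⟨j, rfl⟩; exact hx j⟩⟩
  have hxn : ‖x‖ ≤ 1 := lp.norm_le_of_forall_le zero_le_one hx
  have h := hA x i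
  have e : ∀ j, M i j * x j = (‖M i j‖ : ℂ) := fun j => by
    change M i j * ((starRingEnd ℂ) (M i j) / ‖M i j‖) = _
    rcases eq_or_ne (M i j) 0 with h0 | h0
    · simp [h0]
    · rw [mul_div_assoc', Complex.mul_conj', sq, mul_div_cancel_right₀]
      exact_mod_cast norm_ne_zero_iff.2 h0
  simp_rw [e] at h
  have hs : Summable fun j => ‖M i j‖ := by exact_mod_cast h.summable
  refine ⟨hs, ?_⟩
  have h1 : ((∑' j, ‖M i j‖ : ℝ) : ℂ) = A x i := by
    rw [← h.tsum_eq, Complex.ofReal_tsum]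
  calc ∑' j, ‖M i j‖ = ‖((∑' j, ‖M i j‖ : ℝ) : ℂ)‖ := by
        rw [Complex.norm_real, Real.norm_of_nonneg (tsum_nonneg fun _ => norm_nonneg _)]
    _ = ‖A x i‖ := by rw [h1]
    _ ≤ ‖A x‖ := lp.norm_apply_le_norm (by simp) _ _
    _ ≤ ‖A‖ * ‖x‖ := A.le_opNorm x
    _ ≤ ‖A‖ := mul_le_of_le_one_right (norm_nonneg _) hxn

/-- The matrix of a product of operators is the product of the matrices. -/
lemma IsMatrixOf.mul (hA : IsMatrixOf M A) (hB : IsMatrixOf N B) (hR : IsProd M N R) :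
    IsMatrixOf R (A * B) := by
  have hcol : ∀ i j, HasSum (fun k => M i k * N k j) (A (B (lp.single p j 1)) i) := fun i j => by
    simpa [hB.apply_single] using hA (B (lp.single p j 1)) i
  have hentry : ∀ i j, A (B (lp.single p j 1)) i = R i j := fun i j =>
    tendsto_nhds_unique (hcol i j).tendsto_sum_nat (hR i j)
  intro x i
  by_cases hp : p = ⊤
  -- Finitely supported sequences are not dense in `ℓ^∞`, so the columns do not suffice; absolute
  -- summability of the rows allows Fubini instead.
  · subst hp
    have hs : Summable fun q : ℕ × ℕ => ‖M i q.1 * (N q.1 q.2 * x q.2)‖ := by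
      have hN : ∀ k j, ‖N k j * x j‖ ≤ ‖N k j‖ * ‖x‖ := fun k j => by
        rw [norm_mul]
        gcongr
        exact lp.norm_apply_le_norm (by simp) _ _
      have hNs : ∀ k, Summable fun j => ‖N k j * x j‖ := fun k =>
        Summable.of_nonneg_of_le (fun _ => norm_nonneg _) (hN k)
          ((hB.sum_norm_le k).1.mul_right ‖x‖)
      refine (summable_prod_of_nonneg fun _ => norm_nonneg _).2 ⟨fun k => ?_, ?_⟩
      · simpa only [norm_mul (M i k)] using (hNs k).mul_left ‖M i k‖
      · simp only [norm_mul (M i _), tsum_mul_left]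
        refine Summable.of_nonneg_of_le
          (fun k => mul_nonneg (norm_nonneg _) (tsum_nonneg fun _ => norm_nonneg _)) (fun k => ?_)
          ((hA.sum_norm_le i).1.mul_right (‖B‖ * ‖x‖))
        gcongr
        calc ∑' j, ‖N k j * x j‖ ≤ ∑' j, ‖N k j‖ * ‖x‖ :=
              (hNs k).tsum_le_tsum (hN k) ((hB.sum_norm_le k).1.mul_right ‖x‖)
          _ = (∑' j, ‖N k j‖) * ‖x‖ := tsum_mul_right
          _ ≤ ‖B‖ * ‖x‖ := by gcongr; exact (hB.sum_norm_le k).2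
    have h1 := hs.of_norm.hasSum
    have h2 := h1.prod_fiberwise fun k => (hB x k).mul_left (M i k)
    have h3 := h2.unique (hA (B x) i)
    rw [h3] at h1
    have h4 := (Equiv.prodComm ℕ ℕ).hasSum_iff.2 h1
    refine h4.prod_fiberwise fun j => ?_
    have h5 := (hcol i j).mul_right (x j)
    rw [hentry] at h5
    exact h5.congr_fun fun k => (mul_assoc _ _ _).symm
  -- For `p < ∞`, `x` is the norm limit of its finite sections, so continuity determines the row
  -- series from the columns.
  · have h := ((lp.hasSum_single hp x).mapL (A * B)).mapL
      (lp.evalCLM (𝕜 := ℂ) (fun _ : ℕ => ℂ) p i)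
    have e : ∀ j, lp.evalCLM (𝕜 := ℂ) (fun _ : ℕ => ℂ) p i ((A * B) (lp.single p j (x j))) =
        R i j * x j := fun j => by
      have h1 : lp.single (E := fun _ : ℕ => ℂ) p j (x j) = x j • lp.single p j 1 := by
        rw [← lp.single_smul, smul_eq_mul, mul_one]
      rw [h1, map_smul, map_smul, ← hentry, smul_eq_mul, mul_comm]
      rfl
    simp_rw [e] at h
    exact h

variable {α : ℂ} {a : Circle → ℂ}

lemma IsMatrixOf.pow (ha : Admissible α a) (hA : IsMatrixOf (PAlpha α a) A) (n : ℕ) :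
    IsMatrixOf (PAlpha α (a ^ n)) (A ^ n) := by
  induction n with
  | zero => simpa [PAlpha_one] using isMatrixOf_one
  | succ n ih =>
    rw [pow_succ, pow_succ]
    exact ih.mul hA (Admissible.isProd (pow_mem (S := admissibleAlgebra α) ha n) ha)

lemma IsMatrixOf.aeval (ha : Admissible α a) (hA : IsMatrixOf (PAlpha α a) A)
    (q : Polynomial ℂ) : IsMatrixOf (PAlpha α (Polynomial.aeval a q)) (Polynomial.aeval A q) := by
  induction q using Polynomial.induction_on' with
  | add q r hq hr =>
    rw [map_add, map_add, (ha.aeval q).PAlpha_add (ha.aeval r)]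
    exact hq.add hr
  | monomial n k =>
    rw [Polynomial.aeval_monomial, Polynomial.aeval_monomial, ← Algebra.smul_def,
      ← Algebra.smul_def,
      Admissible.PAlpha_smul (pow_mem (S := admissibleAlgebra α) ha n)]
    exact (hA.pow ha n).smul k

end Operators

/-! ### Boundedness -/

/-- A matrix with uniformly bounded absolute row sums acts on bounded sequences. -/
lemma summable_norm_mul_of_row {M : Matrix ℕ ℕ ℂ} (hs : ∀ i, Summable fun j => ‖M i j‖)
    {p : ℝ≥0∞} [Fact (1 ≤ p)] (x : Ell p) (i : ℕ) : Summable fun j => ‖M i j * x j‖ := by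
  have hp : p ≠ 0 := (zero_lt_one.trans_le Fact.out).ne'
  refine Summable.of_nonneg_of_le (fun _ => norm_nonneg _) (fun j => ?_) ((hs i).mul_right ‖x‖)
  rw [norm_mul]
  gcongr
  exact lp.norm_apply_le_norm hp _ _

lemma exists_isMatrixOf {M : Matrix ℕ ℕ ℂ} (hs : ∀ i, Summable fun j => ‖M i j‖)
    {p : ℝ≥0∞} [Fact (1 ≤ p)] (K : ℝ)
    (hK : ∀ x : Ell p, ∃ y : Ell p, (∀ i, y i = ∑' j, M i j * x j) ∧ ‖y‖ ≤ K * ‖x‖) :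
    ∃ A : Ell p →L[ℂ] Ell p, IsMatrixOf M A := by
  choose f hf hfK using hK
  have hsum := fun (x : Ell p) i => (summable_norm_mul_of_row hs x i).of_norm
  refine ⟨LinearMap.mkContinuous ⟨⟨f, fun x y => ?_⟩, fun c x => ?_⟩ K hfK, fun x i => ?_⟩
  · ext i
    rw [lp.coeFn_add, Pi.add_apply, hf, hf, hf, ← (hsum x i).tsum_add (hsum y i)]
    exact tsum_congr fun j => by simp [mul_add]
  · ext i
    rw [lp.coeFn_smul, Pi.smul_apply, hf]
    simp only [RingHom.id_apply]
    rw [hf, smul_eq_mul, ← tsum_mul_left]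
    exact tsum_congr fun j => by simp [mul_left_comm]
  · change HasSum _ (f x i)
    rw [hf]
    exact (hsum x i).hasSum

lemma exists_isMatrixOf_top {M : Matrix ℕ ℕ ℂ} {K : ℝ} (hs : ∀ i, Summable fun j => ‖M i j‖)
    (hK : ∀ i, ∑' j, ‖M i j‖ ≤ K) : ∃ A : Ell ⊤ →L[ℂ] Ell ⊤, IsMatrixOf M A := by
  have hK0 : 0 ≤ K := (tsum_nonneg fun _ => norm_nonneg _).trans (hK 0)
  refine exists_isMatrixOf hs K fun x => ?_
  have h : ∀ i, ‖∑' j, M i j * x j‖ ≤ K * ‖x‖ := fun i => by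
    have h1 := summable_norm_mul_of_row hs x i
    calc _ ≤ ∑' j, ‖M i j * x j‖ := norm_tsum_le_tsum_norm h1
      _ ≤ ∑' j, ‖M i j‖ * ‖x‖ := h1.tsum_le_tsum (fun j => by
          rw [norm_mul]
          gcongr
          exact lp.norm_apply_le_norm (by simp) _ _) ((hs i).mul_right _)
      _ = (∑' j, ‖M i j‖) * ‖x‖ := tsum_mul_right
      _ ≤ _ := by gcongr; exact hK i
  exact ⟨⟨fun i => ∑' j, M i j * x j, memℓp_infty ⟨_, by rintro _ ⟨i, rfl⟩; exact h i⟩⟩,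
    fun i => rfl, lp.norm_le_of_forall_le (by positivity) h⟩

lemma Ell.sum_sq_le (x : Ell 2) (s : Finset ℕ) : ∑ j ∈ s, ‖x j‖ ^ 2 ≤ ‖x‖ ^ 2 := by
  simpa using lp.sum_rpow_le_norm_rpow (p := 2) (by simp) x s

/-- **Schur's test**. -/
lemma exists_isMatrixOf_two {M : Matrix ℕ ℕ ℂ} {K : ℝ} (hs : ∀ i, Summable fun j => ‖M i j‖)
    (hK : ∀ i, ∑' j, ‖M i j‖ ≤ K) (hcol : ∀ (j : ℕ) (s : Finset ℕ), ∑ i ∈ s, ‖M i j‖ ≤ K) :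
    ∃ A : Ell 2 →L[ℂ] Ell 2, IsMatrixOf M A := by
  have hK0 : 0 ≤ K := (tsum_nonneg fun _ => norm_nonneg _).trans (hK 0)
  refine exists_isMatrixOf hs K fun x => ?_
  have hsq : ∀ i, Summable fun j => ‖M i j‖ * ‖x j‖ ^ 2 := fun i => by
    refine Summable.of_nonneg_of_le (fun j => by positivity) (fun j => ?_)
      ((hs i).mul_right (‖x‖ ^ 2))
    gcongr
    exact lp.norm_apply_le_norm (by simp) _ _
  -- Cauchy-Schwarz with the splitting `|M||x| = |M|^(1/2) · |M|^(1/2)|x|`; the first factor is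
  -- controlled by the row sum.
  have h1 : ∀ i, ‖∑' j, M i j * x j‖ ^ 2 ≤ K * ∑' j, ‖M i j‖ * ‖x j‖ ^ 2 := fun i => by
    have h0 : 0 ≤ ∑' j, ‖M i j‖ * ‖x j‖ ^ 2 := tsum_nonneg fun j => by positivity
    refine (Real.le_sqrt (norm_nonneg _) (by positivity)).1 ?_
    refine (norm_tsum_le_tsum_norm (summable_norm_mul_of_row hs x i)).trans
      (Real.tsum_le_of_sum_le (fun _ => norm_nonneg _) fun s => Real.le_sqrt_of_sq_le ?_)
    calc (∑ j ∈ s, ‖M i j * x j‖) ^ 2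
        ≤ (∑ j ∈ s, ‖M i j‖) * ∑ j ∈ s, ‖M i j‖ * ‖x j‖ ^ 2 :=
          Finset.sum_sq_le_sum_mul_sum_of_sq_le_mul s (fun j _ => norm_nonneg _)
            (fun j _ => by positivity) fun j _ => by rw [norm_mul]; exact (by ring : _ = _).le
      _ ≤ _ := by
          gcongr
          · exact ((hs i).sum_le_tsum s fun _ _ => norm_nonneg _).trans (hK i)
          · exact (hsq i).sum_le_tsum s fun _ _ => by positivity
  have h2 : ∀ s : Finset ℕ, ∑ i ∈ s, ‖∑' j, M i j * x j‖ ^ 2 ≤ (K * ‖x‖) ^ 2 := fun s => by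
    calc _ ≤ ∑ i ∈ s, K * ∑' j, ‖M i j‖ * ‖x j‖ ^ 2 := Finset.sum_le_sum fun i _ => h1 i
      _ = K * ∑' j, ∑ i ∈ s, ‖M i j‖ * ‖x j‖ ^ 2 := by
          rw [← Finset.mul_sum, Summable.tsum_finsetSum fun i _ => hsq i]
      _ ≤ K * (K * ‖x‖ ^ 2) := by
          gcongr
          refine Real.tsum_le_of_sum_le (fun j => Finset.sum_nonneg fun _ _ => by positivity)
            fun t => ?_
          calc _ ≤ ∑ j ∈ t, K * ‖x j‖ ^ 2 := Finset.sum_le_sum fun j _ => by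
                rw [← Finset.sum_mul]
                gcongr
                exact hcol j s
            _ ≤ _ := by
                rw [← Finset.mul_sum]
                gcongr
                exact Ell.sum_sq_le x t
      _ = _ := by ring
  have h3 : ∀ s : Finset ℕ, ∑ i ∈ s, ‖∑' j, M i j * x j‖ ^ (2 : ℝ≥0∞).toReal ≤
      (K * ‖x‖) ^ (2 : ℝ≥0∞).toReal := by simpa using h2
  exact ⟨⟨fun i => ∑' j, M i j * x j, memℓp_gen' h3⟩, fun i => rfl,
    lp.norm_le_of_forall_sum_le (by simp) (by positivity) h3⟩

/-! #### Row sums of `P_α(a)` -/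

/-- Along a row the kernel takes each of the values `α, θ, θα, θα², …` at most once. Removing the
first entry replaces `p` by `p - 1`, hence the induction with `p` free. -/
lemma sum_norm_hankelKernel_le (α : ℂ) (J : ℕ) : ∀ p : ℤ,
    ∑ j ∈ Finset.range J, ‖hankelKernel α (p - j)‖ ≤
      (if 0 ≤ p then ‖α‖ else 0) + ‖α ^ 2 - 1‖ * ∑ t ∈ Finset.range p.toNat, ‖α‖ ^ t := by
  induction J with
  | zero =>
    intro p
    rw [Finset.sum_range_zero]
    have : 0 ≤ (if 0 ≤ p then ‖α‖ else 0) := by split_ifs <;> simp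
    positivity
  | succ J ih =>
    intro p
    rw [Finset.sum_range_succ']
    have h := ih (p - 1)
    have e : ∀ j : ℕ, p - (j + 1 : ℕ) = p - 1 - j := fun j => by push_cast; ring
    simp_rw [e]
    simp only [Nat.cast_zero, sub_zero]
    rcases lt_trichotomy p 0 with hp | rfl | hp
    · rw [if_neg (by omega), show (p - 1).toNat = 0 by omega] at h
      rw [if_neg (by omega), show p.toNat = 0 by omega, hankelKernel_of_neg α hp, norm_zero]
      linarith
    · rw [if_neg (by omega), show ((0 : ℤ) - 1).toNat = 0 by omega] at h
      rw [if_pos le_rfl, hankelKernel_zero]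
      simp only [Finset.sum_range_zero, mul_zero, Int.toNat_zero] at h ⊢
      linarith
    · obtain ⟨t, rfl⟩ : ∃ t : ℕ, p = t + 1 := ⟨(p - 1).toNat, by omega⟩
      rw [if_pos (by omega), show ((t : ℤ) + 1 - 1).toNat = t by omega] at h
      rw [if_pos (by omega), show ((t : ℤ) + 1).toNat = t + 1 by omega, Finset.sum_range_succ,
        hankelKernel_natCast_add_one, norm_mul, norm_pow, mul_add]
      linarith

/-- For `|α| = 1` and `α ≠ ±1` the left side is `|θ| N`, which no constant bounds; this is the
source of the exceptional case for bounded operators. At `α = ±1` the factor `θ` vanishes, and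
otherwise the geometric sum is explicit. -/
lemma exists_geom_sum_le {α : ℂ} (hα : ‖α‖ = 1 → α ^ 2 = 1) : ∃ C, 0 ≤ C ∧ ∀ N n : ℕ, N ≤ n →
    ‖α ^ 2 - 1‖ * ∑ t ∈ Finset.range N, ‖α‖ ^ t ≤ C * max 1 ‖α‖ ^ n := by
  rcases eq_or_ne ‖α‖ 1 with h | h
  · refine ⟨0, le_rfl, fun N n _ => ?_⟩
    simp [hα h]
  · have h0 : 0 < |‖α‖ - 1| := abs_pos.2 (sub_ne_zero.2 h)
    refine ⟨‖α ^ 2 - 1‖ * (2 / |‖α‖ - 1|), by positivity, fun N n hN => ?_⟩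
    rw [mul_assoc]
    gcongr
    rw [geom_sum_eq h]
    refine (le_abs_self _).trans ?_
    rw [abs_div, div_mul_eq_mul_div]
    gcongr
    have h1 : 1 ≤ max 1 ‖α‖ ^ n := one_le_pow₀ (le_max_left _ _)
    have h2 : ‖α‖ ^ N ≤ max 1 ‖α‖ ^ n :=
      (pow_le_pow_left₀ (norm_nonneg _) (le_max_right _ _) _).trans
        (pow_le_pow_right₀ (le_max_left _ _) hN)
    have h3 : 0 ≤ ‖α‖ ^ N := by positivity
    rw [abs_le]
    constructor <;> linarith

lemma exists_sum_norm_PTilde_le {α : ℂ} (hα : ‖α‖ = 1 → α ^ 2 = 1) : ∃ C, 0 ≤ C ∧ ∀ n i J : ℕ,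
    ∑ j ∈ Finset.range J, ‖PTilde α n i j‖ ≤ C * max 1 ‖α‖ ^ n := by
  obtain ⟨C, hC, h⟩ := exists_geom_sum_le hα
  refine ⟨2 + ‖α‖ + C, by positivity, fun n i J => ?_⟩
  have h1 : 1 ≤ max 1 ‖α‖ ^ n := one_le_pow₀ (le_max_left _ _)
  have hd : ∀ (P : ℕ → Prop) [DecidablePred P], (∀ k l, P k → P l → k = l) →
      ∑ k ∈ Finset.range J, ‖(if P k then 1 else 0 : ℂ)‖ ≤ 1 := by
    intro P _ hP
    have e : ∀ k, ‖(if P k then 1 else 0 : ℂ)‖ = if P k then 1 else 0 := fun k => by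
      split_ifs <;> simp
    simp_rw [e]
    rw [Finset.sum_boole, Nat.cast_le_one, Finset.card_le_one]
    intro k hk l hl
    exact hP k l (Finset.mem_filter.1 hk).2 (Finset.mem_filter.1 hl).2
  have e : ∀ j : ℕ, ‖PTilde α n i j‖ ≤ ‖(if (j : ℤ) = i + n then 1 else 0 : ℂ)‖ +
      ‖(if (i : ℤ) = j + n then 1 else 0 : ℂ)‖ + ‖hankelKernel α ((n - i - 1 : ℤ) - j)‖ := fun j => by
    rw [PTilde, show (n : ℤ) - i - j - 1 = n - i - 1 - j by ring]
    exact (norm_add_le _ _).trans (add_le_add_left (norm_add_le _ _) _)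
  have h2 := sum_norm_hankelKernel_le α J (n - i - 1)
  have h3 := h (n - i - 1 : ℤ).toNat n (by omega)
  have h4 : (if (0 : ℤ) ≤ n - i - 1 then ‖α‖ else 0) ≤ ‖α‖ := by split_ifs <;> simp
  have h5 := hd (fun j : ℕ => (j : ℤ) = i + n) (by intros; omega)
  have h6 := hd (fun j : ℕ => (i : ℤ) = j + n) (by intros; omega)
  have h7 := Finset.sum_le_sum fun j (_ : j ∈ Finset.range J) => e j
  rw [Finset.sum_add_distrib, Finset.sum_add_distrib] at h7
  nlinarith [norm_nonneg α]

section Boundedness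

variable {α : ℂ} {a : Circle → ℂ}

lemma Admissible.exists_sum_norm_le (hα : ‖α‖ = 1 → α ^ 2 = 1) (ha : Admissible α a) :
    ∃ K, ∀ i J : ℕ, ∑ j ∈ Finset.range J, ‖PAlpha α a i j‖ ≤ K := by
  obtain ⟨c, hc⟩ := ha.exists_isCoeffs
  obtain ⟨C, hC, h⟩ := exists_sum_norm_PTilde_le hα
  refine ⟨∑' n : ℤ, C * (‖c n‖ * max 1 ‖α‖ ^ n.natAbs), fun i J => ?_⟩
  calc ∑ j ∈ Finset.range J, ‖PAlpha α a i j‖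
      ≤ ∑ j ∈ Finset.range J, ∑' n, ‖c n * PHalf α n i j‖ := Finset.sum_le_sum fun j _ => by
        rw [hc.PAlpha_apply]
        exact norm_tsum_le_tsum_norm (hc.summable_norm_mul_PHalf i j)
    _ = ∑' n, ∑ j ∈ Finset.range J, ‖c n * PHalf α n i j‖ :=
        (Summable.tsum_finsetSum fun j _ => hc.summable_norm_mul_PHalf i j).symm
    _ ≤ _ := (summable_sum fun j _ => hc.summable_norm_mul_PHalf i j).tsum_le_tsum (fun n => by
        have h1 := h n.natAbs i J
        simp_rw [PHalf, norm_mul, norm_div, Complex.norm_ofNat]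
        rw [← Finset.mul_sum, ← Finset.sum_div]
        have h2 : 0 ≤ ∑ j ∈ Finset.range J, ‖PTilde α n.natAbs i j‖ :=
          Finset.sum_nonneg fun _ _ => norm_nonneg _
        calc _ ≤ ‖c n‖ * (C * max 1 ‖α‖ ^ n.natAbs) := by gcongr; linarith
          _ = _ := by ring) (hc.summable.mul_left C)

lemma Admissible.PAlpha_symm (ha : Admissible α a) (i j : ℕ) :
    PAlpha α a i j = PAlpha α a j i := by
  obtain ⟨c, hc⟩ := ha.exists_isCoeffs
  rw [hc.PAlpha_apply, hc.PAlpha_apply]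
  simp_rw [PHalf, PTilde_symm α _ i j]

lemma Admissible.exists_isMatrixOf (hα : ‖α‖ = 1 → α ^ 2 = 1) (ha : Admissible α a)
    {p : ℝ≥0∞} [Fact (1 ≤ p)] (hp : p = 2 ∨ p = ⊤) :
    ∃ A : Ell p →L[ℂ] Ell p, IsMatrixOf (PAlpha α a) A := by
  obtain ⟨K, hK⟩ := ha.exists_sum_norm_le hα
  have hs : ∀ i, Summable fun j => ‖PAlpha α a i j‖ := fun i =>
    summable_of_sum_range_le (fun _ => norm_nonneg _) (hK i)
  have hK' : ∀ i, ∑' j, ‖PAlpha α a i j‖ ≤ K := fun i =>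
    Real.tsum_le_of_sum_range_le (fun _ => norm_nonneg _) (hK i)
  rcases hp with rfl | rfl
  · refine exists_isMatrixOf_two hs hK' fun j s => ?_
    simp_rw [ha.PAlpha_symm _ j]
    exact ((hs j).sum_le_tsum s fun _ _ => norm_nonneg _).trans (hK' j)
  · exact exists_isMatrixOf_top hs hK'

end Boundedness

/-! ### Polynomials and rational functions of `P_α(a)` -/

variable {α : ℂ} {a : Circle → ℂ}

lemma IsProd.unique {A B C D : Matrix ℕ ℕ ℂ} (h : IsProd A B C) (h' : IsProd A B D) : C = D := by
  funext i j
  exact tendsto_nhds_unique (h i j) (h' i j)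

lemma isProd_one_left (A : Matrix ℕ ℕ ℂ) : IsProd 1 A A := by
  intro i j
  refine tendsto_const_nhds.congr' ?_
  filter_upwards [eventually_gt_atTop i] with K hK
  simp [Matrix.one_apply, hK]

lemma PAlpha_sum (s : Finset ℕ) (f : ℕ → Circle → ℂ) (hf : ∀ n, Admissible α (f n)) :
    PAlpha α (∑ n ∈ s, f n) = ∑ n ∈ s, PAlpha α (f n) := by
  induction s using Finset.induction_on with
  | empty =>
    have h := PAlpha_const α 0
    rw [zero_smul] at h
    exact h
  | insert n s hn ih =>
    rw [Finset.sum_insert hn, Finset.sum_insert hn,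
      (hf n).PAlpha_add (sum_mem (S := admissibleAlgebra α) fun k _ => hf k), ih]

namespace Admissible

lemma pow (ha : Admissible α a) (n : ℕ) : Admissible α (a ^ n) :=
  pow_mem (S := admissibleAlgebra α) ha n

lemma PAlpha_aeval (ha : Admissible α a) (q : Polynomial ℂ) :
    PAlpha α (Polynomial.aeval a q) = ∑ n ∈ q.support, q.coeff n • PAlpha α (a ^ n) := by
  have h : Polynomial.aeval a q = ∑ n ∈ q.support, q.coeff n • a ^ n := by
    rw [Polynomial.aeval_def, Polynomial.eval₂_eq_sum, Polynomial.sum_def]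
    exact Finset.sum_congr rfl fun n _ => (Algebra.smul_def _ _).symm
  rw [h, PAlpha_sum _ _ fun n => (admissibleAlgebra α).smul_mem (ha.pow n) _]
  exact Finset.sum_congr rfl fun n _ => (ha.pow n).PAlpha_smul _

/-- Limits are unique, so the powers of `P_α(a)` are forced one after another by multiplicativity.
-/
lemma isPolyValue_iff (ha : Admissible α a) (q : Polynomial ℂ) (C : Matrix ℕ ℕ ℂ) :
    IsPolyValue q (PAlpha α a) C ↔ C = PAlpha α (Polynomial.aeval a q) := by
  rw [ha.PAlpha_aeval]
  constructor
  · rintro ⟨W, hW0, hW, rfl⟩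
    have h : ∀ n, W n = PAlpha α (a ^ n) := by
      intro n
      induction n with
      | zero => rw [hW0, pow_zero, PAlpha_one]
      | succ n ih =>
        have h1 := hW n
        rw [ih] at h1
        rw [pow_succ]
        exact h1.unique ((ha.pow n).isProd ha)
    simp_rw [h]
  · rintro rfl
    refine ⟨fun n => PAlpha α (a ^ n), by simp [PAlpha_one], fun n => ?_, rfl⟩
    simpa only [pow_succ] using (ha.pow n).isProd ha

end Admissible

lemma aeval_apply (a : Circle → ℂ) (q : Polynomial ℂ) (z : Circle) :
    Polynomial.aeval a q z = q.eval (a z) := by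
  simp

section RatFunc

variable (f : RatFunc ℂ)

lemma ratEval_eq (w : ℂ) : ratEval f w = f.num.eval w / f.denom.eval w := by
  simp [ratEval, RatFunc.eval, Polynomial.eval₂_id]

lemma ratEval_comp_eq_mul (a : Circle → ℂ) : (fun z => ratEval f (a z)) =
    Polynomial.aeval a f.num * fun z => (f.denom.eval (a z))⁻¹ := by
  funext z
  rw [Pi.mul_apply, aeval_apply, ratEval_eq, div_eq_mul_inv]

lemma MemWS.inv_denom (ha : MemWS a) (hf : ∀ z, f.denom.eval (a z) ≠ 0) :
    MemWS fun z => (f.denom.eval (a z))⁻¹ := by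
  -- At parameter `0` the condition on symbols is vacuous, so the algebra of admissible symbols is
  -- all of `𝒲_S`.
  have ha' : Admissible 0 a := ⟨ha, Or.inl (by simp)⟩
  simpa only [aeval_apply] using (ha'.aeval f.denom).memWS.inv fun z => by
    rw [aeval_apply]; exact hf z

lemma MemWS.ratEval (ha : MemWS a) (hf : ∀ z, f.denom.eval (a z) ≠ 0) :
    MemWS fun z => ratEval f (a z) := by
  have ha' : Admissible 0 a := ⟨ha, Or.inl (by simp)⟩
  rw [ratEval_comp_eq_mul]
  exact (ha'.aeval f.num).memWS.mul (ha.inv_denom f hf)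

/-- By Bézout, `1 / q(a)` is a polynomial expression in `a` and `(p / q)(a)`. -/
lemma Admissible.inv_denom (ha : Admissible α a) (hf : ∀ z, f.denom.eval (a z) ≠ 0)
    (hfa : Admissible α fun z => ratEval f (a z)) :
    Admissible α fun z => (f.denom.eval (a z))⁻¹ := by
  obtain ⟨u, v, huv⟩ := f.isCoprime_num_denom
  have e : (fun z => (f.denom.eval (a z))⁻¹) =
      Polynomial.aeval a u * (fun z => ratEval f (a z)) + Polynomial.aeval a v := by
    funext z
    have h := congrArg (Polynomial.eval (a z)) huv
    simp only [Polynomial.eval_add, Polynomial.eval_mul, Polynomial.eval_one] at h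
    rw [Pi.add_apply, Pi.mul_apply, aeval_apply, aeval_apply, ratEval_eq]
    have := hf z
    field_simp
    linear_combination -h
  rw [e]
  exact (admissibleAlgebra α).add_mem ((admissibleAlgebra α).mul_mem (ha.aeval u) hfa) (ha.aeval v)

lemma aeval_denom_mul_inv (hf : ∀ z, f.denom.eval (a z) ≠ 0) :
    (Polynomial.aeval a f.denom * fun z => (f.denom.eval (a z))⁻¹) = 1 := by
  funext z
  rw [Pi.mul_apply, aeval_apply]
  exact mul_inv_cancel₀ (hf z)

lemma aeval_denom_mul_ratEval (hf : ∀ z, f.denom.eval (a z) ≠ 0) :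
    (Polynomial.aeval a f.denom * fun z => ratEval f (a z)) = Polynomial.aeval a f.num := by
  rw [ratEval_comp_eq_mul, mul_left_comm, aeval_denom_mul_inv f hf, mul_one]

/-- `f(P_α(a)) = P_α(f ∘ a)` as semi-infinite matrices. -/
theorem Admissible.isRatValue_iff (ha : Admissible α a) (hf : ∀ z, f.denom.eval (a z) ≠ 0)
    (hfa : Admissible α fun z => ratEval f (a z)) (C : Matrix ℕ ℕ ℂ) :
    IsRatValue α f (PAlpha α a) C ↔ C = PAlpha α fun z => ratEval f (a z) := by
  have hg := ha.inv_denom f hf hfa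
  have hq := ha.aeval f.denom
  have hqg := hq.isProd hg
  rw [aeval_denom_mul_inv f hf, PAlpha_one] at hqg
  have hgq := hg.isProd hq
  rw [mul_comm, aeval_denom_mul_inv f hf, PAlpha_one] at hgq
  have hpg := (ha.aeval f.num).isProd hg
  rw [← ratEval_comp_eq_mul] at hpg
  constructor
  · rintro ⟨N, D, E, hN, hD, ⟨b, hb, hb', rfl⟩, hDE, -, hNE⟩
    rw [ha.isPolyValue_iff] at hN hD
    subst hN hD
    have hab : Admissible α b := ⟨hb, hb'⟩
    -- Products of semi-infinite matrices need not associate, so uniqueness of the inverse is argued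
    -- on symbols: multiplying `P_α(q(a) b) = 1` by `P_α(1/q(a))` gives `P_α(b) = P_α(1/q(a))`. One
    -- of the two inverse relations suffices.
    have h1 : PAlpha α (Polynomial.aeval a f.denom * b) = 1 := (hq.isProd hab).unique hDE
    have h2 := Admissible.isProd ((admissibleAlgebra α).mul_mem hq hab) hg
    rw [h1, mul_right_comm, aeval_denom_mul_inv f hf, one_mul] at h2
    rw [h2.unique (isProd_one_left _)] at hNE
    exact hNE.unique hpg
  · rintro rfl
    exact ⟨_, _, _, (ha.isPolyValue_iff _ _).2 rfl, (ha.isPolyValue_iff _ _).2 rfl,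
      ⟨_, hg.memWS, hg.symbolCond, rfl⟩, hqg, hgq, hpg⟩

/-- `f(P_α(a)) = P_α(f ∘ a)` as bounded operators. -/
theorem Admissible.ratOp_eq (ha : Admissible α a) (hf : ∀ z, f.denom.eval (a z) ≠ 0)
    (hfa : Admissible α fun z => ratEval f (a z)) {p : ℝ≥0∞} [Fact (1 ≤ p)]
    {A B : Ell p →L[ℂ] Ell p} (hA : IsMatrixOf (PAlpha α a) A)
    (hB : IsMatrixOf (PAlpha α fun z => ratEval f (a z)) B) :
    IsUnit (Polynomial.aeval A f.denom) ∧ ratOp f A = B := by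
  have hq := ha.aeval f.denom
  have hqA := hA.aeval ha f.denom
  have hpA := hA.aeval ha f.num
  have h1 : Polynomial.aeval A f.denom * B = Polynomial.aeval A f.num := by
    have h := hqA.mul hB (hq.isProd hfa)
    rw [aeval_denom_mul_ratEval f hf] at h
    exact h.unique hpA
  have h2 : B * Polynomial.aeval A f.denom = Polynomial.aeval A f.num := by
    have h := hB.mul hqA (hfa.isProd hq)
    rw [mul_comm, aeval_denom_mul_ratEval f hf] at h
    exact h.unique hpA
  obtain ⟨u, v, huv⟩ := f.isCoprime_num_denom
  have h3 : Polynomial.aeval A u * Polynomial.aeval A f.num +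
      Polynomial.aeval A v * Polynomial.aeval A f.denom = 1 := by
    rw [← map_mul, ← map_mul, ← map_add, huv, map_one]
  have hcomm : ∀ r s : Polynomial ℂ, Polynomial.aeval A r * Polynomial.aeval A s =
      Polynomial.aeval A s * Polynomial.aeval A r := fun r s => by
    rw [← map_mul, mul_comm, map_mul]
  -- The inverse `u(A) B + v(A)` is built from `A` and `B` alone, so `P_α(1/q(a))` need not be known
  -- to be bounded. This covers the case `|α| = 1`, `α ≠ ±1`.
  have hunit : IsUnit (Polynomial.aeval A f.denom) := by
    refine ⟨⟨_, Polynomial.aeval A u * B + Polynomial.aeval A v, ?_, ?_⟩, rfl⟩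
    · rw [mul_add, ← mul_assoc, hcomm f.denom u, mul_assoc, h1, hcomm f.denom v, h3]
    · rw [add_mul, mul_assoc, h2, h3]
  refine ⟨hunit, ?_⟩
  rw [ratOp, ← h2, Ring.mul_inverse_cancel_right _ _ hunit]

end RatFunc

end QTAlgebra

end

theorem mainTheorem5 (α : ℂ) (a : Circle → ℂ) (ha : QTAlgebra.MemWS a) :
    -- inversion
    ((∀ z, a z ≠ 0) →
      QTAlgebra.MemWS (fun z => (a z)⁻¹) ∧
      (QTAlgebra.SymbolCond α a → QTAlgebra.SymbolCond α (fun z => (a z)⁻¹) →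
        QTAlgebra.PAlphaConverges α a ∧
        QTAlgebra.PAlphaConverges α (fun z => (a z)⁻¹) ∧
        QTAlgebra.IsProd (QTAlgebra.PAlpha α (fun z => (a z)⁻¹)) (QTAlgebra.PAlpha α a) 1)) ∧
    -- rational functions without poles on the image of the circle
    (∀ f : RatFunc ℂ, (∀ z, f.denom.eval (a z) ≠ 0) →
      QTAlgebra.MemWS (fun z => QTAlgebra.ratEval f (a z)) ∧
      (QTAlgebra.SymbolCond α a → QTAlgebra.SymbolCond α (fun z => QTAlgebra.ratEval f (a z)) →
        QTAlgebra.PAlphaConverges α a ∧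
        QTAlgebra.PAlphaConverges α (fun z => QTAlgebra.ratEval f (a z)) ∧
        -- the identity for semi-infinite matrices
        (∀ C : Matrix ℕ ℕ ℂ, QTAlgebra.IsRatValue α f (QTAlgebra.PAlpha α a) C ↔
          C = QTAlgebra.PAlpha α (fun z => QTAlgebra.ratEval f (a z))) ∧
        -- the identity for bounded operators on `ℓ²` and `ℓ^∞`
        (∀ (p : ENNReal) [Fact (1 ≤ p)], p = 2 ∨ p = ⊤ →
          (∀ A B : QTAlgebra.Ell p →L[ℂ] QTAlgebra.Ell p,
            QTAlgebra.IsMatrixOf (QTAlgebra.PAlpha α a) A →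
            QTAlgebra.IsMatrixOf (QTAlgebra.PAlpha α (fun z => QTAlgebra.ratEval f (a z))) B →
            IsUnit (Polynomial.aeval A f.denom) ∧ QTAlgebra.ratOp f A = B) ∧
          ((‖α‖ = 1 → α ^ 2 = 1) →
            (∃ A : QTAlgebra.Ell p →L[ℂ] QTAlgebra.Ell p,
              QTAlgebra.IsMatrixOf (QTAlgebra.PAlpha α a) A) ∧
            (∃ B : QTAlgebra.Ell p →L[ℂ] QTAlgebra.Ell p,
              QTAlgebra.IsMatrixOf
                (QTAlgebra.PAlpha α (fun z => QTAlgebra.ratEval f (a z))) B))))) := by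

  refine ⟨fun hne => ⟨ha.inv hne, fun hs hs' => ?_⟩, fun f hf => ⟨ha.ratEval f hf, fun hs hs' => ?_⟩⟩
  · have h1 : QTAlgebra.Admissible α a := ⟨ha, hs⟩
    have h2 : QTAlgebra.Admissible α fun z => (a z)⁻¹ := ⟨ha.inv hne, hs'⟩
    refine ⟨h1.converges, h2.converges, ?_⟩
    have h := h2.isProd h1
    rwa [show ((fun z => (a z)⁻¹) * a) = 1 from funext fun z => inv_mul_cancel₀ (hne z),
      QTAlgebra.PAlpha_one] at h
  · have h1 : QTAlgebra.Admissible α a := ⟨ha, hs⟩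
    have h2 : QTAlgebra.Admissible α fun z => QTAlgebra.ratEval f (a z) := ⟨ha.ratEval f hf, hs'⟩
    exact ⟨h1.converges, h2.converges, h1.isRatValue_iff f hf h2, fun p _ hp =>
      ⟨fun A B hA hB => h1.ratOp_eq f hf h2 hA hB, fun hα =>
        ⟨h1.exists_isMatrixOf hα hp, h2.exists_isMatrixOf hα hp⟩⟩⟩
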